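/- All rings are commutative with unit. For a ring $R$ and $m\ge 0$ let $K^M_m(R)=(R^*)^{\otimes_{\mathbb Z} m}/\mathrm{St}_m(R)$ be the Milnor $K$-group, where $\mathrm{St}_m(R)$ is the subgroup generated by the tensors $r_1\otimes\cdots\otimes r_i\otimes r\otimes(1-r)\otimes r_{i+1}\otimes\cdots\otimes r_{m-2}$ with $r_1,\dots,r_{m-2},r,1-r\in R^*$, and write $\{r_1,\dots,r_m\}$ for the class of $r_1\otimes\cdots\otimes r_m$. Let $\Omega^m_R=\bigwedge^m_R\Omega^1_{R/\mathbb Z}$ be the module of absolute differential forms, with de Rham differential $d$. For an ideal $I\subset R$ put $K^M_m(R,I)=\ker(K^M_m(R)\to K^M_m(R/I))$ and $\Omega^m_{R,I}=\ker(\Omega^m_R\to\Omega^m_{R/I})$, with the convention $\Omega^{-1}_{R,I}=0$. **Theorem.** Let $R$ be a ring, $I\subset R$ an ideal and $N\ge 1$ an integer such that $I^N=0$. Suppose that the quotient map $R\to R/I$ admits a splitting by a ring homomorphism $R/I\to R$ and that $N!$ is invertible in $R$. Then for every $n\ge 0$ there exists a unique group homomorphism $$\mathrm B\colon K^M_{n+1}(R,I)\longrightarrow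 \Omega^n_{R,I}/d\,\Omega^{n-1}_{R,I}$$ (the Bloch map) such that for all $0\le i\le n$, $r_1,\dots,r_n\in R^*$ and $x\in I$, $$\mathrm B\{r_1,\dots,r_i,1+x,r_{i+1},\dots,r_n\}=(-1)^i\log(1+x)\,\frac{dr_1}{r_1}\wedge\cdots\wedge\frac{dr_n}{r_n},$$ where the right-hand side denotes the class of the form in the quotient and $\log(1+x)=\sum_{k=1}^{N-1}(-1)^{k+1}x^k/k$. Moreover, $\mathrm B$ is an integral of $d\log$: for every $\kappa\in K^M_{n+1}(R,I)$ and every form $\omega\in\Omega^n_{R,I}$ representing $\mathrm B(\kappa)$ one has $d\omega=d\log(\kappa)$ in $\Omega^{n+1}_R$, where $d\log\colon K^M_{n+1}(R)\to\Omega^{n+1}_R$ is the homomorphism $\{r_1,\dots,r_{n+1}\}\mapsto \frac{dr_1}{r_1}\wedge\cdots\wedge\frac{dr_{n+1}}{r_{n+1}}$. -/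

import Mathlib

noncomputable section

namespace BlochMap

universe u v

open scoped TensorProduct KaehlerDifferential

/-! ### Milnor K-groups -/

section Milnor

variable (R : Type u) [CommRing R] (n : ℕ)

/-- The tensor power `(R^*)^{⊗ n}` over `ℤ`, written additively. -/
abbrev UnitsTensor : Type u := ⨂[ℤ] _ : Fin n, Additive Rˣ

variable {R n} in
/-- The pure tensor `r_1 ⊗ ⋯ ⊗ r_n`. -/
def pureTensor (r : Fin n → Rˣ) : UnitsTensor R n :=
  PiTensorProduct.tprod ℤ fun j => Additive.ofMul (r j)

/-- The subgroup `St_n(R)` generated by the Steinberg relations: the pure tensors having two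
consecutive entries of the form `r, 1 - r`. -/
def steinberg : AddSubgroup (UnitsTensor R n) :=
  AddSubgroup.closure {t | ∃ (r : Fin n → Rˣ) (i j : Fin n),
    (j : ℕ) = (i : ℕ) + 1 ∧ (r j : R) = 1 - (r i : R) ∧ t = pureTensor r}

/-- The Milnor K-group `K_n^M(R) = (R^*)^{⊗ n} / St_n(R)`, written additively. -/
abbrev MilnorK : Type u := UnitsTensor R n ⧸ steinberg R n

variable {R n} in
/-- The symbol `{r_1, …, r_n}`. -/
def symbol (r : Fin n → Rˣ) : MilnorK R n :=
  QuotientAddGroup.mk (pureTensor r)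

variable {R n} {S : Type v} [CommRing S]

/-- The map `(R^*)^{⊗ n} → (S^*)^{⊗ n}` induced by a ring homomorphism. -/
def unitsTensorMap (f : R →+* S) : UnitsTensor R n →+ UnitsTensor S n :=
  (PiTensorProduct.map (R := ℤ) fun _ : Fin n =>
    (MonoidHom.toAdditive (Units.map (f : R →* S))).toIntLinearMap).toAddMonoidHom

lemma unitsTensorMap_pureTensor (f : R →+* S) (r : Fin n → Rˣ) :
    unitsTensorMap f (pureTensor r) = pureTensor fun j => Units.map (f : R →* S) (r j) := by
  simp only [unitsTensorMap, pureTensor, LinearMap.toAddMonoidHom_coe, PiTensorProduct.map_tprod]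
  rfl

/-- The map `K_n^M(R) → K_n^M(S)` induced by a ring homomorphism. -/
def milnorKMap (f : R →+* S) : MilnorK R n →+ MilnorK S n :=
  QuotientAddGroup.map _ _ (unitsTensorMap f) (by
    rw [steinberg, AddSubgroup.closure_le]
    rintro _ ⟨r, i, j, hij, hr, rfl⟩
    refine AddSubgroup.subset_closure ⟨_, i, j, hij, ?_, unitsTensorMap_pureTensor f r⟩
    simp [hr])

lemma milnorKMap_symbol (f : R →+* S) (r : Fin n → Rˣ) :
    milnorKMap f (symbol r) = symbol fun j => Units.map (f : R →* S) (r j) := by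
  rw [symbol, milnorKMap, QuotientAddGroup.map_mk, unitsTensorMap_pureTensor]
  rfl

lemma symbol_eq_zero (r : Fin n → Rˣ) (i : Fin n) (h : r i = 1) : symbol r = 0 := by
  have : pureTensor r = 0 := (PiTensorProduct.tprod ℤ).map_coord_zero i (by rw [h]; rfl)
  rw [symbol, this]
  rfl

/-- The relative Milnor K-group `K_n^M(R, I) = Ker (K_n^M(R) → K_n^M(R/I))`. -/
def relMilnorK (I : Ideal R) (n : ℕ) : AddSubgroup (MilnorK R n) :=
  (milnorKMap (Ideal.Quotient.mk I)).ker

lemma symbol_mem_relMilnorK (I : Ideal R) (r : Fin n → Rˣ) (i : Fin n) {x : R} (hx : x ∈ I)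
    (h : (r i : R) = 1 + x) : symbol r ∈ relMilnorK I n := by
  rw [relMilnorK, AddMonoidHom.mem_ker, milnorKMap_symbol]
  refine symbol_eq_zero _ i (Units.ext ?_)
  simp [h, Ideal.Quotient.eq_zero_iff_mem.mpr hx]

end Milnor

/-! ### Differential forms and the de Rham differential -/

section Forms

variable (R : Type u) [CommRing R]

/-- The `R`-module `Ω^n_R = ⋀^n Ω^1_R` of absolute differential forms of degree `n`. -/
abbrev Forms (n : ℕ) : Type u := ⋀[R]^n Ω[R⁄ℤ]

/-- The exterior algebra of `Ω^1_R`, in which all the `Ω^n_R` live. -/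
abbrev AllForms : Type u := ExteriorAlgebra R Ω[R⁄ℤ]

variable {R} in
/-- The `1`-form `dr`, as an element of the exterior algebra. -/
abbrev dd (r : R) : AllForms R := ExteriorAlgebra.ι R (KaehlerDifferential.D ℤ R r)

variable {R} in
/-- The wedge product `ω_1 ∧ ⋯ ∧ ω_n`. -/
abbrev wedge {n : ℕ} (ω : Fin n → Ω[R⁄ℤ]) : Forms R n := exteriorPower.ιMulti R n ω

/-- Pairs of forms, with the `R`-module structure `r • (a, b) = (r a, r b + dr ∧ a)`.
An additive map `d` with `d (r a) = r d a + dr ∧ a` is the same thing as an `R`-linear map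
`a ↦ (a, d a)`; this auxiliary module is used only to construct the de Rham differential. -/
def Twisted : Type u := AllForms R × AllForms R

instance : AddCommGroup (Twisted R) := inferInstanceAs (AddCommGroup (AllForms R × AllForms R))

instance : SMul R (Twisted R) := ⟨fun r p => (r • p.1, r • p.2 + dd r * p.1)⟩

variable {R}

lemma Twisted.smul_def (r : R) (p : Twisted R) :
    r • p = ((r • p.1, r • p.2 + dd r * p.1) : AllForms R × AllForms R) := rfl

lemma dd_add (r s : R) : dd (r + s) = dd r + dd s := by simp [dd]

lemma dd_mul (r s : R) : dd (r * s) = r • dd s + s • dd r := by simp [dd]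

instance : Module R (Twisted R) where
  one_smul p := by
    refine Prod.ext ?_ ?_
    · exact one_smul R p.1
    · change (1 : R) • p.2 + dd (1 : R) * p.1 = p.2
      simp [dd]
  mul_smul r s p := by
    refine Prod.ext ?_ ?_
    · exact mul_smul r s p.1
    · change (r * s) • p.2 + dd (r * s) * p.1
        = r • (s • p.2 + dd s * p.1) + dd r * (s • p.1)
      simp only [dd_mul, mul_smul, smul_add, add_mul, smul_mul_assoc, mul_smul_comm]
      abel
  smul_zero r := by
    refine Prod.ext ?_ ?_
    · exact smul_zero _
    · change r • (0 : AllForms R) + dd r * 0 = 0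
      simp
  smul_add r p q := by
    refine Prod.ext ?_ ?_
    · exact smul_add _ _ _
    · change r • (p.2 + q.2) + dd r * (p.1 + q.1) = (r • p.2 + dd r * p.1) + (r • q.2 + dd r * q.1)
      simp only [smul_add, mul_add]
      abel
  add_smul r s p := by
    refine Prod.ext ?_ ?_
    · exact add_smul _ _ _
    · change (r + s) • p.2 + dd (r + s) * p.1 = (r • p.2 + dd r * p.1) + (s • p.2 + dd s * p.1)
      simp only [add_smul, dd_add, add_mul]
      abel
  zero_smul p := by
    refine Prod.ext ?_ ?_
    · exact zero_smul _ _
    · change (0 : R) • p.2 + dd (0 : R) * p.1 = 0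
      simp [dd]

lemma ι_mul_ι_anti (x y : Ω[R⁄ℤ]) :
    ExteriorAlgebra.ι R x * ExteriorAlgebra.ι R y
      = -(ExteriorAlgebra.ι R y * ExteriorAlgebra.ι R x) :=
  eq_neg_of_add_eq_zero_left (ExteriorAlgebra.ι_add_mul_swap x y)

variable (R) in
/-- The derivation `r ↦ (dr, 0)` with values in the twisted module. -/
def twistedDer : Derivation ℤ R (Twisted R) where
  toFun r := ((dd r, 0) : AllForms R × AllForms R)
  map_add' r s := by
    refine Prod.ext ?_ ?_
    · exact dd_add r s
    · exact (add_zero _).symm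
  map_smul' k r := by
    refine Prod.ext ?_ ?_
    · change dd (k • r) = k • dd r
      rw [dd, Derivation.map_smul, map_zsmul]
    · exact (smul_zero _).symm
  map_one_eq_zero' := by
    refine Prod.ext ?_ rfl
    change dd (1 : R) = 0
    simp [dd]
  leibniz' r s := by
    refine Prod.ext ?_ ?_
    · exact dd_mul r s
    · change (0 : AllForms R) = (r • (0 : AllForms R) + dd r * dd s) + (s • 0 + dd s * dd r)
      rw [smul_zero, smul_zero, zero_add, zero_add]
      exact (ExteriorAlgebra.ι_add_mul_swap _ _).symm

variable (R) in
/-- The `R`-linear map `ω ↦ (ω, dω)` on `1`-forms. -/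
def twistedOne : Ω[R⁄ℤ] →ₗ[R] Twisted R := (twistedDer R).liftKaehlerDifferential

lemma twistedOne_D (r : R) :
    twistedOne R (KaehlerDifferential.D ℤ R r) = ((dd r, 0) : AllForms R × AllForms R) :=
  (twistedDer R).liftKaehlerDifferential_comp_D r

@[elab_as_elim]
lemma oneForm_induction {p : Ω[R⁄ℤ] → Prop} (ω : Ω[R⁄ℤ])
    (D : ∀ r, p (KaehlerDifferential.D ℤ R r)) (zero : p 0)
    (add : ∀ x y, p x → p y → p (x + y)) (smul : ∀ (r : R) x, p x → p (r • x)) : p ω := by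
  have h : ω ∈ Submodule.span R (Set.range (KaehlerDifferential.D ℤ R)) := by
    rw [KaehlerDifferential.span_range_derivation]; trivial
  induction h using Submodule.span_induction with
  | mem x hx => obtain ⟨r, rfl⟩ := hx; exact D r
  | zero => exact zero
  | add x y _ _ hx hy => exact add x y hx hy
  | smul r x _ hx => exact smul r x hx

lemma twistedOne_fst (ω : Ω[R⁄ℤ]) : (twistedOne R ω).1 = ExteriorAlgebra.ι R ω := by
  induction ω using oneForm_induction with
  | D r => rw [twistedOne_D]
  | zero => rw [map_zero, map_zero]; rfl
  | add x y hx hy => rw [map_add, map_add, ← hx, ← hy]; rfl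
  | smul r x hx => rw [map_smul, map_smul, ← hx]; rfl

/-- The differential of a `1`-form. -/
def dOne (ω : Ω[R⁄ℤ]) : AllForms R := (twistedOne R ω).2

lemma dOne_D (r : R) : dOne (KaehlerDifferential.D ℤ R r) = 0 := by
  rw [dOne, twistedOne_D]

lemma dOne_add (x y : Ω[R⁄ℤ]) : dOne (x + y) = dOne x + dOne y := by
  simp only [dOne, map_add]; rfl

lemma dOne_zero : dOne (0 : Ω[R⁄ℤ]) = 0 := by
  simp only [dOne, map_zero]; rfl

lemma dOne_smul (r : R) (x : Ω[R⁄ℤ]) :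
    dOne (r • x) = r • dOne x + dd r * ExteriorAlgebra.ι R x := by
  rw [← twistedOne_fst]
  simp only [dOne, map_smul]; rfl

/-- Differentials of `1`-forms commute with `1`-forms. -/
lemma dOne_comm (x y : Ω[R⁄ℤ]) :
    dOne x * ExteriorAlgebra.ι R y = ExteriorAlgebra.ι R y * dOne x := by
  induction x using oneForm_induction with
  | D r => simp [dOne_D]
  | zero => simp [dOne_zero]
  | add x y hx hy => rw [dOne_add, add_mul, mul_add, hx, hy]
  | smul r x hx =>
    rw [dOne_smul, add_mul, mul_add, smul_mul_assoc, mul_smul_comm, hx, mul_assoc,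
      ι_mul_ι_anti x y, mul_neg, ← mul_assoc, ι_mul_ι_anti _ y, neg_mul, neg_neg, mul_assoc]

variable (R) in
/-- Left multiplication by a `1`-form `ω` on the pairs `(a, da)`, namely
`(a, b) ↦ (ω ∧ a, dω ∧ a - ω ∧ b)`. -/
def twistedMul : Ω[R⁄ℤ] →ₗ[R] Twisted R →ₗ[R] Twisted R :=
  LinearMap.mk₂ R
    (fun ω p => ((ExteriorAlgebra.ι R ω * p.1, dOne ω * p.1 - ExteriorAlgebra.ι R ω * p.2) :
      AllForms R × AllForms R))
    (by
      intro x y p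
      refine Prod.ext ?_ ?_
      · change ExteriorAlgebra.ι R (x + y) * p.1
          = ExteriorAlgebra.ι R x * p.1 + ExteriorAlgebra.ι R y * p.1
        rw [map_add, add_mul]
      · change dOne (x + y) * p.1 - ExteriorAlgebra.ι R (x + y) * p.2
          = (dOne x * p.1 - ExteriorAlgebra.ι R x * p.2)
            + (dOne y * p.1 - ExteriorAlgebra.ι R y * p.2)
        rw [map_add, add_mul, dOne_add, add_mul]
        abel)
    (by
      intro r x p
      refine Prod.ext ?_ ?_
      · change ExteriorAlgebra.ι R (r • x) * p.1 = r • (ExteriorAlgebra.ι R x * p.1)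
        rw [map_smul, smul_mul_assoc]
      · change dOne (r • x) * p.1 - ExteriorAlgebra.ι R (r • x) * p.2
          = r • (dOne x * p.1 - ExteriorAlgebra.ι R x * p.2)
            + dd r * (ExteriorAlgebra.ι R x * p.1)
        rw [map_smul, smul_mul_assoc, dOne_smul, add_mul, smul_mul_assoc, smul_sub, mul_assoc]
        abel)
    (by
      intro x p q
      refine Prod.ext ?_ ?_
      · exact mul_add _ _ _
      · change dOne x * (p.1 + q.1) - ExteriorAlgebra.ι R x * (p.2 + q.2)
          = (dOne x * p.1 - ExteriorAlgebra.ι R x * p.2)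
            + (dOne x * q.1 - ExteriorAlgebra.ι R x * q.2)
        rw [mul_add, mul_add]
        abel)
    (by
      intro r x p
      refine Prod.ext ?_ ?_
      · exact mul_smul_comm _ _ _
      · change dOne x * (r • p.1) - ExteriorAlgebra.ι R x * (r • p.2 + dd r * p.1)
          = r • (dOne x * p.1 - ExteriorAlgebra.ι R x * p.2)
            + dd r * (ExteriorAlgebra.ι R x * p.1)
        rw [mul_smul_comm, mul_add, mul_smul_comm, smul_sub, ← mul_assoc, ι_mul_ι_anti x,
          neg_mul, mul_assoc]
        abel)

lemma twistedMul_apply (ω : Ω[R⁄ℤ]) (p : Twisted R) : twistedMul R ω p =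
    ((ExteriorAlgebra.ι R ω * p.1, dOne ω * p.1 - ExteriorAlgebra.ι R ω * p.2) :
      AllForms R × AllForms R) := rfl

lemma twistedMul_sq (ω : Ω[R⁄ℤ]) (p : Twisted R) :
    twistedMul R ω (twistedMul R ω p) = (0 : QuadraticForm R Ω[R⁄ℤ]) ω • p := by
  rw [_root_.zero_apply, zero_smul, twistedMul_apply, twistedMul_apply]
  refine Prod.ext ?_ ?_
  · change ExteriorAlgebra.ι R ω * (ExteriorAlgebra.ι R ω * p.1) = 0
    rw [← mul_assoc, ExteriorAlgebra.ι_sq_zero, zero_mul]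
  · change dOne ω * (ExteriorAlgebra.ι R ω * p.1)
      - ExteriorAlgebra.ι R ω * (dOne ω * p.1 - ExteriorAlgebra.ι R ω * p.2) = 0
    rw [mul_sub, ← mul_assoc, ← mul_assoc, ← mul_assoc, ExteriorAlgebra.ι_sq_zero, dOne_comm]
    simp

variable (R) in
/-- The `R`-linear map `a ↦ (a, da)` on the exterior algebra. -/
def twistedAll : AllForms R →ₗ[R] Twisted R :=
  CliffordAlgebra.foldr (0 : QuadraticForm R Ω[R⁄ℤ]) (twistedMul R) twistedMul_sq
    ((1, 0) : AllForms R × AllForms R)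

lemma twistedAll_one : twistedAll R 1 = ((1, 0) : AllForms R × AllForms R) :=
  CliffordAlgebra.foldr_one _ _ _ _

lemma twistedAll_ι_mul (ω : Ω[R⁄ℤ]) (a : AllForms R) :
    twistedAll R (ExteriorAlgebra.ι R ω * a) = twistedMul R ω (twistedAll R a) := by
  have h := CliffordAlgebra.foldr_mul (0 : QuadraticForm R Ω[R⁄ℤ]) (twistedMul R) twistedMul_sq
    ((1, 0) : AllForms R × AllForms R) (ExteriorAlgebra.ι R ω) a
  refine h.trans ?_
  exact CliffordAlgebra.foldr_ι _ _ _ _ _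

variable (R) in
/-- The de Rham differential on the exterior algebra. -/
def dAll : AllForms R →+ AllForms R where
  toFun a := (twistedAll R a).2
  map_zero' := by rw [map_zero]; rfl
  map_add' a b := by rw [map_add]; rfl

lemma twistedAll_prod (r : List R) : twistedAll R (r.map dd).prod
    = (((r.map dd).prod, 0) : AllForms R × AllForms R) := by
  induction r with
  | nil => exact twistedAll_one
  | cons s r ih =>
    rw [List.map_cons, List.prod_cons, twistedAll_ι_mul, ih]
    refine Prod.ext rfl ?_
    change dOne (KaehlerDifferential.D ℤ R s) * (r.map dd).prod - dd s * 0 = 0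
    rw [dOne_D, zero_mul, mul_zero, sub_zero]

lemma dAll_smul_prod (s : R) (r : List R) :
    dAll R (s • (r.map dd).prod) = dd s * (r.map dd).prod := by
  change (twistedAll R (s • (r.map dd).prod)).2 = _
  rw [map_smul, twistedAll_prod]
  change s • (0 : AllForms R) + dd s * (r.map dd).prod = _
  rw [smul_zero, zero_add]

lemma wedge_D_coe {n : ℕ} (r : Fin n → R) :
    (wedge (fun j => KaehlerDifferential.D ℤ R (r j)) : AllForms R)
      = ((List.ofFn r).map dd).prod := by
  rw [exteriorPower.ιMulti_apply_coe, ExteriorAlgebra.ιMulti_apply, List.map_ofFn]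
  rfl

/-- Additive generators `s dr_1 ∧ ⋯ ∧ dr_n` of `Ω^n_R`. -/
@[elab_as_elim]
lemma forms_induction {n : ℕ} {p : Forms R n → Prop} (ω : Forms R n)
    (gen : ∀ (s : R) (r : Fin n → R),
      p (s • wedge (fun j => KaehlerDifferential.D ℤ R (r j))))
    (add : ∀ x y, p x → p y → p (x + y)) : p ω := by
  have hspan := exteriorPower.ιMulti_span_of_span R n Ω[R⁄ℤ]
    (KaehlerDifferential.span_range_derivation ℤ R)
  have zero : p 0 := by simpa using gen 0 0
  suffices h : ∀ s : R, p (s • ω) by simpa using h 1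
  have h : ω ∈ Submodule.span R (exteriorPower.ιMulti R n '' {a : Fin n → Ω[R⁄ℤ] |
      Set.range a ⊆ Set.range (KaehlerDifferential.D ℤ R)}) := by
    rw [hspan]; trivial
  induction h using Submodule.span_induction with
  | mem x hx =>
    obtain ⟨a, ha, rfl⟩ := hx
    have : ∀ j, ∃ r, KaehlerDifferential.D ℤ R r = a j := fun j => ha ⟨j, rfl⟩
    choose r hr using this
    obtain rfl : (fun j => KaehlerDifferential.D ℤ R (r j)) = a := funext hr
    exact fun s => gen s r
  | zero => intro s; rwa [smul_zero]
  | add x y _ _ hx hy => intro s; rw [smul_add]; exact add _ _ (hx s) (hy s)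
  | smul t x _ hx => intro s; rw [smul_smul]; exact hx _

lemma dAll_smul_wedge {n : ℕ} (s : R) (r : Fin n → R) :
    dAll R ((s • wedge (fun j => KaehlerDifferential.D ℤ R (r j)) : Forms R n) : AllForms R)
      = (wedge (fun j => KaehlerDifferential.D ℤ R ((Fin.cons s r : Fin (n + 1) → R) j)) :
          Forms R (n + 1)) := by
  rw [Submodule.coe_smul, wedge_D_coe, wedge_D_coe, dAll_smul_prod, List.ofFn_cons]
  simp

lemma dAll_mem {n : ℕ} (ω : Forms R n) : dAll R (ω : AllForms R) ∈ ⋀[R]^(n + 1) Ω[R⁄ℤ] := by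
  induction ω using forms_induction with
  | gen s r => rw [dAll_smul_wedge]; exact Subtype.prop _
  | add x y hx hy => rw [Submodule.coe_add, map_add]; exact add_mem hx hy

variable (R) in
/-- The de Rham differential `d : Ω^n_R → Ω^{n+1}_R`. -/
def deRham (n : ℕ) : Forms R n →+ Forms R (n + 1) where
  toFun ω := ⟨dAll R (ω : AllForms R), dAll_mem ω⟩
  map_zero' := Subtype.ext (dAll R).map_zero
  map_add' x y := Subtype.ext ((dAll R).map_add x.val y.val)

/-- The formula `d (s dr_1 ∧ ⋯ ∧ dr_n) = ds ∧ dr_1 ∧ ⋯ ∧ dr_n`, which determines `d`. -/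
lemma deRham_smul_wedge {n : ℕ} (s : R) (r : Fin n → R) :
    deRham R n (s • wedge (fun j => KaehlerDifferential.D ℤ R (r j)))
      = wedge (fun j => KaehlerDifferential.D ℤ R ((Fin.cons s r : Fin (n + 1) → R) j)) :=
  Subtype.ext (dAll_smul_wedge s r)

end Forms

/-! ### Relative differential forms -/

section Relative

variable {R : Type u} [CommRing R]

variable (R) in
/-- The `R`-linear map `Ω^n_R → Ω^n_S` induced by the structure map of an `R`-algebra `S`. -/
def formsMap (S : Type v) [CommRing S] [Algebra R S] (n : ℕ) : Forms R n →ₗ[R] Forms S n :=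
  exteriorPower.alternatingMapLinearEquiv
    { ((exteriorPower.ιMulti S n (M := Ω[S⁄ℤ])).toMultilinearMap.restrictScalars
          R).compLinearMap (fun _ => KaehlerDifferential.map ℤ ℤ R S) with
      map_eq_zero_of_eq' := fun _ _ _ h hij =>
        (exteriorPower.ιMulti S n (M := Ω[S⁄ℤ])).map_eq_zero_of_eq _
          (congrArg (KaehlerDifferential.map ℤ ℤ R S) h) hij }

lemma formsMap_wedge {S : Type v} [CommRing S] [Algebra R S] {n : ℕ} (ω : Fin n → Ω[R⁄ℤ]) :
    formsMap R S n (wedge ω) = wedge fun j => KaehlerDifferential.map ℤ ℤ R S (ω j) :=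
  exteriorPower.alternatingMapLinearEquiv_apply_ιMulti _ _

lemma formsMap_deRham {S : Type v} [CommRing S] [Algebra R S] {n : ℕ} (ω : Forms R n) :
    formsMap R S (n + 1) (deRham R n ω) = deRham S n (formsMap R S n ω) := by
  induction ω using forms_induction with
  | gen s r =>
    rw [deRham_smul_wedge, formsMap_wedge, map_smul, formsMap_wedge]
    simp only [KaehlerDifferential.map_D]
    rw [← algebraMap_smul S s, deRham_smul_wedge]
    congr 1
    funext j
    refine Fin.cases ?_ (fun i => ?_) j <;> simp
  | add x y hx hy => simp only [map_add, hx, hy]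

/-- The relative module of differential forms `Ω^n_{R,I} = Ker (Ω^n_R → Ω^n_{R/I})`. -/
def relForms (I : Ideal R) (n : ℕ) : Submodule R (Forms R n) :=
  LinearMap.ker (formsMap R (R ⧸ I) n)

/-- The relative de Rham differential `d : Ω^n_{R,I} → Ω^{n+1}_{R,I}`. -/
def relDeRham (I : Ideal R) (n : ℕ) : relForms I n →+ relForms I (n + 1) where
  toFun ω := ⟨deRham R n ω.val, by
    have h : formsMap R (R ⧸ I) n ω.val = 0 := ω.2
    rw [relForms, LinearMap.mem_ker, formsMap_deRham, h, map_zero]⟩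
  map_zero' := Subtype.ext (deRham R n).map_zero
  map_add' x y := Subtype.ext ((deRham R n).map_add x.val y.val)

/-- The subgroup `d Ω^{n-1}_{R,I}` of `Ω^n_{R,I}`, with the convention `Ω^{-1}_{R,I} = 0`. -/
def relExact (I : Ideal R) : (n : ℕ) → AddSubgroup (relForms I n)
  | 0 => ⊥
  | n + 1 => (relDeRham I n).range

lemma smul_mem_relForms {I : Ideal R} {n : ℕ} {a : R} (ha : a ∈ I) (ω : Forms R n) :
    a • ω ∈ relForms I n := by
  rw [relForms, LinearMap.mem_ker, map_smul, ← algebraMap_smul (R ⧸ I) a,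
    Ideal.Quotient.algebraMap_eq, Ideal.Quotient.eq_zero_iff_mem.mpr ha, zero_smul]

end Relative

/-! ### The homomorphism `d log` and Bloch maps -/

section Bloch

variable {R : Type u} [CommRing R]

/-- The logarithmic differential `dr / r` of a unit. -/
def dlogUnit (r : Rˣ) : Ω[R⁄ℤ] := ((r⁻¹ : Rˣ) : R) • KaehlerDifferential.D ℤ R (r : R)

lemma dlogUnit_mul (r s : Rˣ) : dlogUnit (r * s) = dlogUnit r + dlogUnit s := by
  have h1 : ((s⁻¹ : Rˣ) : R) * s = 1 := s.inv_mul
  have h2 : ((r⁻¹ : Rˣ) : R) * r = 1 := r.inv_mul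
  simp only [dlogUnit, mul_inv_rev, Units.val_mul, Derivation.leibniz, smul_add, smul_smul]
  rw [add_comm]
  congr 2
  · linear_combination ((r⁻¹ : Rˣ) : R) * h1
  · linear_combination ((s⁻¹ : Rˣ) : R) * h2

variable (R) in
/-- `dlogUnit` as a homomorphism `R^* → Ω^1_R`. -/
def dlogOne : Additive Rˣ →+ Ω[R⁄ℤ] where
  toFun r := dlogUnit r.toMul
  map_zero' := by simp [dlogUnit]
  map_add' r s := dlogUnit_mul _ _

variable (R) in
/-- The homomorphism `(R^*)^{⊗ n} → Ω^n_R`, `r_1 ⊗ ⋯ ⊗ r_n ↦ dr_1/r_1 ∧ ⋯ ∧ dr_n/r_n`. -/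
def dlogTensor (n : ℕ) : UnitsTensor R n →+ Forms R n :=
  (PiTensorProduct.lift
    (((exteriorPower.ιMulti R n (M := Ω[R⁄ℤ])).toMultilinearMap.restrictScalars
      ℤ).compLinearMap fun _ => (dlogOne R).toIntLinearMap)).toAddMonoidHom

lemma dlogTensor_pureTensor {n : ℕ} (r : Fin n → Rˣ) :
    dlogTensor R n (pureTensor r) = wedge fun j => dlogUnit (r j) := by
  simp only [dlogTensor, pureTensor, LinearMap.toAddMonoidHom_coe, PiTensorProduct.lift.tprod]
  rfl

/-- `dr/r ∧ d(1-r)/(1-r) = 0`. -/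
lemma wedge_dlog_steinberg {n : ℕ} (r : Fin n → Rˣ) (i j : Fin n) (hij : i ≠ j)
    (h : (r j : R) = 1 - (r i : R)) : wedge (fun k => dlogUnit (r k)) = 0 := by
  have hj : dlogUnit (r j)
      = (-(((r j)⁻¹ : Rˣ) : R) * (r i : R)) • dlogUnit (r i) := by
    rw [dlogUnit, dlogUnit, h, map_sub, Derivation.map_one_eq_zero, zero_sub, smul_smul,
      mul_assoc, Units.mul_inv, mul_one, smul_neg, neg_smul]
  have hu : (fun k => dlogUnit (r k)) = Function.update (fun k => dlogUnit (r k)) j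
      ((-(((r j)⁻¹ : Rˣ) : R) * (r i : R)) • dlogUnit (r i)) := by
    rw [← hj]
    exact (Function.update_eq_self j _).symm
  have hz : exteriorPower.ιMulti R n
      (Function.update (fun k => dlogUnit (r k)) j (dlogUnit (r i))) = 0 :=
    AlternatingMap.map_eq_zero_of_eq _ _ (by simp [Function.update_of_ne hij]) hij
  rw [hu, wedge, AlternatingMap.map_update_smul, hz, smul_zero]

variable (R) in
/-- The homomorphism `d log : K_n^M(R) → Ω^n_R`,
`{r_1, …, r_n} ↦ dr_1/r_1 ∧ ⋯ ∧ dr_n/r_n`. -/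
def dlog (n : ℕ) : MilnorK R n →+ Forms R n :=
  QuotientAddGroup.lift _ (dlogTensor R n) (by
    rw [steinberg, AddSubgroup.closure_le]
    rintro _ ⟨r, i, j, hij, hr, rfl⟩
    have hne : i ≠ j := fun e => by rw [e] at hij; omega
    exact (dlogTensor_pureTensor r).trans (wedge_dlog_steinberg r i j hne hr))

lemma dlog_symbol {n : ℕ} (r : Fin n → Rˣ) :
    dlog R n (symbol r) = wedge fun j => dlogUnit (r j) :=
  dlogTensor_pureTensor r

/-- The truncated logarithm `log (1 + x) = x - x²/2 + ⋯ + (-1)^N x^{N-1}/(N-1)`; here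
`Ring.inverse k` is the inverse of `k` in `R`, to be used when `(N-1)!` is invertible in `R`. -/
def logOneAdd (N : ℕ) (x : R) : R :=
  ∑ k ∈ Finset.Ico 1 N, (-1) ^ (k + 1) * Ring.inverse (k : R) * x ^ k

lemma logOneAdd_mem {I : Ideal R} (N : ℕ) {x : R} (hx : x ∈ I) : logOneAdd N x ∈ I :=
  I.sum_mem fun k hk => I.mul_mem_left _
    (I.pow_mem_of_mem hx k (by have := (Finset.mem_Ico.mp hk).1; omega))

/-- The element `log (1 + x) dr_1/r_1 ∧ ⋯ ∧ dr_n/r_n` of `Ω^n_{R,I}`, for `x ∈ I`. -/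
def logForm {I : Ideal R} (N : ℕ) {n : ℕ} {x : R} (hx : x ∈ I) (r : Fin n → Rˣ) :
    relForms I n :=
  ⟨logOneAdd N x • wedge fun j => dlogUnit (r j), smul_mem_relForms (logOneAdd_mem N hx) _⟩

/-- The symbol `{r_1, …, r_i, u, r_{i+1}, …, r_n}` in `K_{n+1}^M(R, I)`, for `u = 1 + x`
with `x ∈ I`. -/
def relSymbol {I : Ideal R} {n : ℕ} {x : R} (hx : x ∈ I) (u : Rˣ) (hu : (u : R) = 1 + x)
    (i : Fin (n + 1)) (r : Fin n → Rˣ) : relMilnorK I (n + 1) :=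
  ⟨symbol (Fin.insertNth i u r : Fin (n + 1) → Rˣ),
    symbol_mem_relMilnorK I _ i hx (by rw [Fin.insertNth_apply_same, hu])⟩

/-- The group `Ω^n_{R,I} / d Ω^{n-1}_{R,I}`. -/
abbrev RelFormsModExact (I : Ideal R) (n : ℕ) : Type u := relForms I n ⧸ relExact I n

/-- A homomorphism `B : K_{n+1}^M(R, I) → Ω^n_{R,I} / d Ω^{n-1}_{R,I}` is a *Bloch map* if
`B {r_1, …, r_i, 1 + x, r_{i+1}, …, r_n}` is the class of
`(-1)^i log (1 + x) dr_1/r_1 ∧ ⋯ ∧ dr_n/r_n` for all `0 ≤ i ≤ n`, units `r_1, …, r_n` and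
`x ∈ I`. (Here `u` is the unit `1 + x`; it exists for every `x ∈ I` when `I` is nilpotent.) -/
def IsBlochMap (I : Ideal R) (N n : ℕ)
    (B : relMilnorK I (n + 1) →+ RelFormsModExact I n) : Prop :=
  ∀ (i : Fin (n + 1)) (r : Fin n → Rˣ) (x : R) (hx : x ∈ I) (u : Rˣ) (hu : (u : R) = 1 + x),
    B (relSymbol hx u hu i r)
      = QuotientAddGroup.mk (((-1 : ℤ) ^ (i : ℕ)) • logForm N hx r)

end Bloch

end BlochMap

end

/-!
The Bloch map of a split nilpotent extension is the integral of `d log` along the nilpotent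
direction, and it can be written down on tensors of units before any relation is imposed.

Let `σ` be the endomorphism `R → R/I → R`. Every unit is `r = σ r · (r / σ r)` with `r / σ r` in
`1 + I`. As the truncated logarithm is additive on `1 + I` (`logOneAdd_mul`), `λ r = log (r / σ r)`
is a homomorphism `R^* → I`, and `dr/r = d(σ r)/σ r + d(λ r)` (`SplitNilpotent.dlogUnit_eq`); here
the invertibility of `N`, and not only of `(N - 1)!`, enters, since it gives `x ^ (N - 1) dx = 0`.
Expanding `d log` of a tensor of length `n` along this decomposition suggests the primitive
`B (r_0, r_1, …) = λ r_0 · dr_1/r_1 ∧ ⋯ - d(σ r_0)/σ r_0 ∧ B (r_1, …)`, which is multilinear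
(`SplitNilpotent.integralMulti`) and satisfies
`d B (r) = dr_0/r_0 ∧ ⋯ - d(σ r_0)/σ r_0 ∧ ⋯` (`SplitNilpotent.dAll_integral`).

Modulo `d Ω_{R,I}`, two facts remain, and both reduce to two adjacent entries, because multiplying
by a closed form `da/a` preserves exact forms.
* Steinberg relation: for `t = 1 - r` the form `λ r · dt/t - λ t · d(σ r)/σ r` is `df` with `f ∈ I`
  (`SplitNilpotent.exists_dilog`). Writing `r = a + x`, the element `f` is a truncation of
  `- ∫ log (1 + x/a) / (1 - a - x) dx`; the coefficients of the integrand satisfy a two-term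
  recursion, from which closedness follows by induction (`derivation_dilogCoeff`).
* Value on symbols: if `w ∈ 1 + I`, exchanging `w` with its left neighbour `a` changes the sign of
  `B` up to `d (λ a · λ w)` (`SplitNilpotent.integral_insertNth`).

Uniqueness holds because the relative K-group is generated by symbols with an entry in `1 + I`:
an element of it is killed by `σ`, and retracting the entries of a symbol one at a time changes it
by such symbols (`SplitNilpotent.relMilnorK_hom_ext`). For the same reason `d log` of the retracted
symbol disappears on the relative K-group, so that `d B = d log` there.
-/

noncomputable section

namespace BlochMap

universe u v

open scoped TensorProduct KaehlerDifferential

/-! ### The truncated logarithm -/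

section Log

open Polynomial

lemma isUnit_natCast_of_factorial {R : Type u} [CommRing R] {N : ℕ}
    (h : IsUnit (N.factorial : R)) {k : ℕ} (hk : 0 < k) (hkN : k ≤ N) : IsUnit (k : R) :=
  isUnit_of_dvd_unit (Nat.cast_dvd_cast (Nat.dvd_factorial hk hkN)) h

lemma map_ringInverse_of_isUnit {R : Type u} {S : Type v} [CommRing R] [CommRing S]
    (f : R →+* S) {a : R} (ha : IsUnit a) : f (Ring.inverse a) = Ring.inverse (f a) := by
  have h := ha.map f
  rw [← h.mul_right_inj, Ring.mul_inverse_cancel _ h, ← map_mul, Ring.mul_inverse_cancel _ ha,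
    map_one]

lemma map_logOneAdd {R : Type u} {S : Type v} [CommRing R] [CommRing S] (f : R →+* S) {N : ℕ}
    (hN : IsUnit (N.factorial : R)) (x : R) :
    f (logOneAdd N x) = logOneAdd N (f x) := by
  simp only [logOneAdd, map_sum, map_mul, map_pow, map_neg, map_one]
  refine Finset.sum_congr rfl fun k hk => ?_
  obtain ⟨h1, h2⟩ := Finset.mem_Ico.mp hk
  rw [map_ringInverse_of_isUnit f (isUnit_natCast_of_factorial hN h1 h2.le), map_natCast]

lemma logOneAdd_zero {R : Type u} [CommRing R] (N : ℕ) : logOneAdd N (0 : R) = 0 :=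
  Finset.sum_eq_zero fun k hk => by
    rw [zero_pow (by have := (Finset.mem_Ico.mp hk).1; omega), mul_zero]

lemma logOneAdd_add_two {R : Type u} [CommRing R] (M : ℕ) (x : R) :
    logOneAdd (M + 2) x
      = logOneAdd (M + 1) x + (-1) ^ M * Ring.inverse ((M + 1 : ℕ) : R) * x ^ (M + 1) := by
  rw [logOneAdd, Finset.sum_Ico_succ_top (by omega), logOneAdd, pow_succ, pow_succ, mul_neg_one,
    mul_neg_one, neg_neg]

section Derivation

variable {k A M : Type*} [CommRing k] [CommRing A] [Algebra k A] [AddCommGroup M] [Module A M]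
  [Module k M] (D : Derivation k A M)

lemma derivation_ringInverse_natCast {m : ℕ} (hm : IsUnit (m : A)) :
    D (Ring.inverse (m : A)) = 0 := by
  have h := congrArg D (Ring.mul_inverse_cancel _ hm)
  rw [Derivation.leibniz, Derivation.map_natCast, smul_zero, add_zero,
    Derivation.map_one_eq_zero] at h
  exact hm.smul_eq_zero.mp h

lemma derivation_neg_one_pow (m : ℕ) : D ((-1) ^ m) = 0 := by
  rcases neg_one_pow_eq_or A m with h | h <;> rw [h] <;> simp

/-- A monomial of the logarithm series: the denominator cancels against the exponent. -/
lemma derivation_log_term {m : ℕ} (hm : IsUnit ((m + 1 : ℕ) : A)) (c w : A) (hc : D c = 0) :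
    D (c * Ring.inverse ((m + 1 : ℕ) : A) * w ^ (m + 1)) = (c * w ^ m) • D w := by
  rw [Derivation.leibniz, Derivation.leibniz, hc, derivation_ringInverse_natCast D hm,
    smul_zero, smul_zero, add_zero, smul_zero, add_zero, Derivation.leibniz_pow,
    Nat.add_sub_cancel, ← Nat.cast_smul_eq_nsmul A, smul_smul, smul_smul]
  congr 1
  linear_combination c * w ^ m * Ring.mul_inverse_cancel _ hm

lemma one_add_smul_derivation_logOneAdd_succ {N : ℕ} (hN : IsUnit (N.factorial : A)) (w : A) :
    (1 + w) • D (logOneAdd (N + 1) w) = (1 - (-w) ^ N) • D w := by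
  induction N with
  | zero => simp [logOneAdd]
  | succ N ih =>
    have h1 : IsUnit ((N + 1 : ℕ) : A) := isUnit_natCast_of_factorial hN (by omega) le_rfl
    have h2 : IsUnit (N.factorial : A) :=
      isUnit_of_dvd_unit (Nat.cast_dvd_cast (Nat.factorial_dvd_factorial (by omega))) hN
    rw [logOneAdd_add_two, map_add, smul_add, ih h2,
      derivation_log_term D h1 _ _ (derivation_neg_one_pow D N), smul_smul, ← add_smul]
    congr 1
    rw [pow_succ (-w) N, neg_pow w N]
    ring

/-- `D log (1 + w) = D w / (1 + w)`; since the series is truncated, this needs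
`w ^ (N - 1) D w = 0`. -/
lemma one_add_smul_derivation_logOneAdd {N : ℕ} (hN1 : 1 ≤ N) (hN : IsUnit (N.factorial : A))
    {w : A} (hw : w ^ (N - 1) • D w = 0) :
    (1 + w) • D (logOneAdd N w) = D w := by
  obtain ⟨N, rfl⟩ := Nat.exists_eq_add_of_le' hN1
  have h2 : IsUnit (N.factorial : A) :=
    isUnit_of_dvd_unit (Nat.cast_dvd_cast (Nat.factorial_dvd_factorial (by omega))) hN
  rw [Nat.add_sub_cancel] at hw
  rw [one_add_smul_derivation_logOneAdd_succ D h2, sub_smul, one_smul, neg_pow, mul_smul, hw,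
    smul_zero, sub_zero]

/-- The invertibility of the full exponent `N` is what kills `x ^ (N - 1) dx`. -/
lemma pow_pred_smul_derivation_eq_zero {N : ℕ} (hN : IsUnit (N : A)) {x : A} (hx : x ^ N = 0) :
    x ^ (N - 1) • D x = 0 := by
  have h := congrArg D hx
  rw [Derivation.leibniz_pow, map_zero, ← Nat.cast_smul_eq_nsmul A] at h
  exact hN.smul_eq_zero.mp h

end Derivation

variable {R : Type u} [CommRing R] {I : Ideal R} {N : ℕ}

lemma pow_eq_zero_of_mem (hI : I ^ N = ⊥) {x : R} (hx : x ∈ I) : x ^ N = 0 := by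
  have := Ideal.pow_mem_pow hx N
  rwa [hI, Ideal.mem_bot] at this

lemma logOneAdd_mem_reesAlgebra (hN : IsUnit (N.factorial : R)) {w : R[X]}
    (hw : w ∈ reesAlgebra I) : logOneAdd N w ∈ reesAlgebra I := by
  refine Subalgebra.sum_mem _ fun k hk => ?_
  obtain ⟨h1, h2⟩ := Finset.mem_Ico.mp hk
  refine mul_mem (mul_mem (pow_mem (neg_mem (one_mem _)) _) ?_) (pow_mem hw _)
  rw [← map_natCast (algebraMap R R[X]),
    ← map_ringInverse_of_isUnit _ (isUnit_natCast_of_factorial hN h1 h2.le)]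
  exact Subalgebra.algebraMap_mem _ _

/-- The truncated logarithm is additive. Along the path `T ↦ (1 + x T, 1 + y T)` the defect
`log (1 + x T) + log (1 + y T) - log ((1 + x T) (1 + y T))` has derivative zero, and its `k`-th
coefficient lies in `I ^ k`; so every coefficient vanishes, those with `k < N` because `k` is
invertible and the others because `I ^ N = 0`. -/
lemma logOneAdd_mul (hN1 : 1 ≤ N) (hI : I ^ N = ⊥) (hN : IsUnit (N.factorial : R)) {x y : R}
    (hx : x ∈ I) (hy : y ∈ I) :
    logOneAdd N (x + y + x * y) = logOneAdd N x + logOneAdd N y := by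
  have hN' : IsUnit (N.factorial : R[X]) := by
    rw [← map_natCast (C : R →+* R[X])]; exact hN.map C
  set J : Ideal R[X] := I.map C with hJ
  have hJN : J ^ N = ⊥ := by rw [hJ, ← Ideal.map_pow, hI, Ideal.map_bot]
  have hlog : ∀ w ∈ J, derivative w ∈ J →
      (1 + w) * derivative (logOneAdd N w) = derivative w := by
    intro w hw hw'
    refine one_add_smul_derivation_logOneAdd (derivative' : Derivation R R[X] R[X]) hN1 hN' ?_
    have h : w ^ (N - 1) * derivative w ∈ J ^ (N - 1) * J :=
      Ideal.mul_mem_mul (Ideal.pow_mem_pow hw _) hw'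
    rw [← pow_succ, Nat.sub_add_cancel hN1, hJN, Ideal.mem_bot] at h
    exact h
  have hCx : C x ∈ J := Ideal.mem_map_of_mem C hx
  have hCy : C y ∈ J := Ideal.mem_map_of_mem C hy
  set p : R[X] := C x * X with hp
  set q : R[X] := C y * X with hq
  have hpJ : p ∈ J := J.mul_mem_right _ hCx
  have hqJ : q ∈ J := J.mul_mem_right _ hCy
  have hp' : derivative p = C x := by simp [hp]
  have hq' : derivative q = C y := by simp [hq]
  have hw' : derivative (p + q + p * q) = C x + C y + (C x * q + p * C y) := by
    rw [derivative_add, derivative_add, derivative_mul (f := p) (g := q), hp', hq']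
  have e1 := hlog p hpJ (hp' ▸ hCx)
  have e2 := hlog q hqJ (hq' ▸ hCy)
  have e3 := hlog (p + q + p * q) (J.add_mem (J.add_mem hpJ hqJ) (J.mul_mem_right _ hpJ))
    (hw' ▸ J.add_mem (J.add_mem hCx hCy) (J.add_mem (J.mul_mem_right _ hCx)
      (J.mul_mem_left _ hCy)))
  rw [hp'] at e1
  rw [hq'] at e2
  rw [hw'] at e3
  set f : R[X] := logOneAdd N (p + q + p * q) - (logOneAdd N p + logOneAdd N q) with hf
  have hunit : ∀ w ∈ J, IsUnit (1 + w) := fun w hw =>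
    IsNilpotent.isUnit_one_add ⟨N, pow_eq_zero_of_mem hJN hw⟩
  have hder : derivative f = 0 := by
    have : ((1 + p) * (1 + q)) * derivative f = 0 := by
      rw [hf, derivative_sub, derivative_add]
      linear_combination e3 - (1 + q) * e1 - (1 + p) * e2
    exact ((hunit p hpJ).mul (hunit q hqJ)).mul_right_eq_zero.mp this
  have hmem : ∀ z ∈ I, C z * X ∈ reesAlgebra I := fun z hz => by
    rw [C_mul_X_eq_monomial, reesAlgebra.monomial_mem, pow_one]; exact hz
  have hrees : f ∈ reesAlgebra I := by
    have h1 := hmem x hx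
    have h2 := hmem y hy
    exact sub_mem (logOneAdd_mem_reesAlgebra hN (add_mem (add_mem h1 h2) (mul_mem h1 h2)))
      (add_mem (logOneAdd_mem_reesAlgebra hN h1) (logOneAdd_mem_reesAlgebra hN h2))
  have hzero : f = 0 := by
    ext k
    rw [coeff_zero]
    rcases Nat.eq_zero_or_pos k with rfl | hk
    · have h : ∀ w : R[X], w.coeff 0 = constantCoeff w := fun _ => rfl
      rw [h, hf, map_sub, map_add, map_logOneAdd _ hN', map_logOneAdd _ hN',
        map_logOneAdd _ hN']
      simp [hp, hq, logOneAdd_zero]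
    · by_cases hkN : N ≤ k
      · have h := Ideal.pow_le_pow_right hkN ((mem_reesAlgebra_iff I f).mp hrees k)
        rwa [hI, Ideal.mem_bot] at h
      · obtain ⟨m, rfl⟩ := Nat.exists_eq_add_of_le' hk
        have h := congrArg (fun w => coeff w m) hder
        simp only [coeff_derivative, coeff_zero] at h
        have hu : IsUnit ((m + 1 : ℕ) : R) :=
          isUnit_natCast_of_factorial hN (by omega) (by omega)
        rw [Nat.cast_succ] at hu
        exact hu.mul_left_eq_zero.mp h
  have h := congrArg (evalRingHom (1 : R)) hzero
  rw [hf, map_sub, map_add, map_logOneAdd _ hN', map_logOneAdd _ hN', map_logOneAdd _ hN',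
    map_zero, sub_eq_zero] at h
  simpa [hp, hq] using h

/-- `d log (1 + x) = dx / (1 + x)` in `Ω¹_R`, for the truncated logarithm. -/
lemma D_logOneAdd (hN1 : 1 ≤ N) (hN : IsUnit (N.factorial : R)) {x : R} (hx : x ^ N = 0)
    (w : Rˣ) (hw : (w : R) = 1 + x) :
    KaehlerDifferential.D ℤ R (logOneAdd N x) = dlogUnit w := by
  have h := one_add_smul_derivation_logOneAdd (KaehlerDifferential.D ℤ R) hN1 hN
    (pow_pred_smul_derivation_eq_zero _ (isUnit_natCast_of_factorial hN hN1 le_rfl) hx)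
  have h' : KaehlerDifferential.D ℤ R (w : R) = KaehlerDifferential.D ℤ R x := by
    rw [hw, map_add, Derivation.map_one_eq_zero, zero_add]
  rw [dlogUnit, h', ← h, ← hw, smul_smul, Units.inv_mul, one_smul]

end Log

/-! ### The truncated dilogarithm -/

section Dilog

variable {R : Type u} [CommRing R]

/-- The coefficients `c_m` of `- log (1 + p X) / (b - X) = ∑ c_m X ^ m`, where `q = 1 / b`. -/
def dilogCoeff (p q : R) : ℕ → R
  | 0 => 0
  | m + 1 => q * dilogCoeff p q m
      + (-1) ^ (m + 1) * Ring.inverse ((m + 1 : ℕ) : R) * p ^ (m + 1) * q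

/-- Integrating the series `∑ c_m X ^ m` termwise gives a truncated dilogarithm. -/
def dilogSum (p q x : R) (M : ℕ) : R :=
  ∑ m ∈ Finset.range M, dilogCoeff p q m * Ring.inverse ((m + 1 : ℕ) : R) * x ^ (m + 1)

/-- The truncated form of `(b - X) * ∑ c_m X ^ m = - log (1 + p X)`. -/
lemma sub_mul_sum_dilogCoeff (p q b x : R) (hq : q * b = 1) (M : ℕ) :
    (b - x) * ∑ m ∈ Finset.range (M + 1), dilogCoeff p q m * x ^ m
      = -logOneAdd (M + 1) (p * x) - dilogCoeff p q M * x ^ (M + 1) := by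
  induction M with
  | zero => simp [logOneAdd, dilogCoeff]
  | succ M ih =>
    rw [Finset.sum_range_succ, mul_add, ih, logOneAdd_add_two, dilogCoeff, mul_pow]
    linear_combination (dilogCoeff p q M
      + (-1) ^ (M + 1) * Ring.inverse ((M + 1 : ℕ) : R) * p ^ (M + 1)) * x ^ (M + 1) * hq

/-- Closedness of the form to be integrated, coefficient by coefficient. Here `ω` stands for
`da`, and `p = 1 / a`, `q = 1 / (1 - a)`. -/
lemma derivation_dilogCoeff {k M : Type*} [CommRing k] [Algebra k R] [AddCommGroup M]
    [Module R M] [Module k M] (D : Derivation k R M) {p q : R} {ω : M}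
    (hp : D p = (-p ^ 2) • ω) (hq : D q = (q ^ 2) • ω) (m : ℕ)
    (hm : IsUnit ((m + 1).factorial : R)) :
    D (dilogCoeff p q m) = ((m + 1 : ℕ) * dilogCoeff p q (m + 1) + p * q ^ (m + 1)) • ω := by
  induction m with
  | zero =>
    have : (0 : R) = (0 + 1 : ℕ) * dilogCoeff p q (0 + 1) + p * q ^ (0 + 1) := by
      simp [dilogCoeff]
    rw [← this, dilogCoeff, map_zero, zero_smul]
  | succ m ih =>
    have hm1 : IsUnit ((m + 1).factorial : R) :=
      isUnit_of_dvd_unit (Nat.cast_dvd_cast (Nat.factorial_dvd_factorial (by omega))) hm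
    have h1 : IsUnit ((m + 1 : ℕ) : R) := isUnit_natCast_of_factorial hm1 (by omega) le_rfl
    have h2 : IsUnit ((m + 1 + 1 : ℕ) : R) := isUnit_natCast_of_factorial hm (by omega) le_rfl
    have e2 := Ring.mul_inverse_cancel _ h2
    have hc : D ((-1) ^ (m + 1)) = 0 := derivation_neg_one_pow D _
    rw [dilogCoeff, map_add, Derivation.leibniz, Derivation.leibniz,
      derivation_log_term D h1 _ _ hc, ih hm1, hp, hq]
    simp only [smul_smul, ← add_smul]
    congr 1
    have d1 : dilogCoeff p q (m + 1) = q * dilogCoeff p q m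
      + (-1) ^ (m + 1) * Ring.inverse ((m + 1 : ℕ) : R) * p ^ (m + 1) * q := rfl
    have d2 : dilogCoeff p q (m + 1 + 1) = q * dilogCoeff p q (m + 1)
      + (-1) ^ (m + 1 + 1) * Ring.inverse ((m + 1 + 1 : ℕ) : R) * p ^ (m + 1 + 1) * q := rfl
    rw [d2]
    push_cast at e2 d1 ⊢
    linear_combination (-(-1) ^ (m + 1 + 1) * p ^ (m + 1 + 1) * q) * e2 - q * d1

/-- The differential of the truncated dilogarithm: its `dx`-component is the integrand by
construction, and its `da`-component is determined by `derivation_dilogCoeff`. -/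
lemma derivation_dilogSum {k M : Type*} [CommRing k] [Algebra k R] [AddCommGroup M]
    [Module R M] [Module k M] (D : Derivation k R M) {p q : R} {ω : M}
    (hp : D p = (-p ^ 2) • ω) (hq : D q = (q ^ 2) • ω) (x : R) (m : ℕ)
    (hm : IsUnit (m.factorial : R)) :
    D (dilogSum p q x m)
      = (∑ j ∈ Finset.range m, dilogCoeff p q j * x ^ j) • D x
        + (∑ j ∈ Finset.range (m + 1), dilogCoeff p q j * x ^ j
            - p * logOneAdd (m + 1) (-(q * x))) • ω := by
  induction m with
  | zero => simp [dilogSum, dilogCoeff, logOneAdd]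
  | succ m ih =>
    have hm1 : IsUnit (m.factorial : R) :=
      isUnit_of_dvd_unit (Nat.cast_dvd_cast (Nat.factorial_dvd_factorial (by omega))) hm
    have h1 : IsUnit ((m + 1 : ℕ) : R) := isUnit_natCast_of_factorial hm (by omega) le_rfl
    have e1 := Ring.mul_inverse_cancel _ h1
    have hterm : D (dilogCoeff p q m * Ring.inverse ((m + 1 : ℕ) : R) * x ^ (m + 1))
        = (dilogCoeff p q m * x ^ m) • D x
          + ((dilogCoeff p q (m + 1) + Ring.inverse ((m + 1 : ℕ) : R) * p * q ^ (m + 1))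
              * x ^ (m + 1)) • ω := by
      have h := derivation_log_term D h1 1 x D.map_one_eq_zero
      rw [one_mul, one_mul] at h
      rw [mul_assoc, Derivation.leibniz, h, derivation_dilogCoeff D hp hq m hm, smul_smul,
        smul_smul]
      congr 2
      linear_combination dilogCoeff p q (m + 1) * x ^ (m + 1) * e1
    rw [dilogSum, Finset.sum_range_succ, map_add, ← dilogSum, ih hm1, hterm,
      logOneAdd_add_two, Finset.sum_range_succ _ (m + 1), Finset.sum_range_succ _ m,
      neg_pow (q * x), mul_pow]
    have hs : ((-1 : R) ^ m) * (-1) ^ (m + 1) = -1 := by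
      rw [← pow_add, show m + (m + 1) = 2 * m + 1 by ring, pow_succ, pow_mul]; simp
    rw [add_add_add_comm, ← add_smul, ← add_smul]
    congr 2
    linear_combination (p * Ring.inverse ((m + 1 : ℕ) : R) * q ^ (m + 1) * x ^ (m + 1)) * hs

end Dilog

/-! ### Units of a split nilpotent extension -/

/-- A retraction `σ` of `R` onto a subring along a nilpotent ideal `I`, with `I ^ N = 0` and `N!`
invertible. The subring is a copy of `R/I`, and working with the endomorphism `σ` of `R` avoids
changing rings. -/
structure SplitNilpotent {R : Type u} [CommRing R] (I : Ideal R) (N : ℕ) where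
  /-- The retraction, as an endomorphism of `R`. -/
  σ : R →+* R
  sub_map_mem : ∀ r, r - σ r ∈ I
  map_eq_zero : ∀ x ∈ I, σ x = 0
  one_le : 1 ≤ N
  pow_eq_bot : I ^ N = ⊥
  isUnit_factorial : IsUnit (N.factorial : R)

namespace SplitNilpotent

variable {R : Type u} [CommRing R] {I : Ideal R} {N : ℕ} (S : SplitNilpotent I N)

/-- The effect of `σ` on units. -/
def retract : Rˣ →* Rˣ := Units.map (S.σ : R →* R)

@[simp]
lemma coe_retract (r : Rˣ) : (S.retract r : R) = S.σ r := rfl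

lemma mul_inv_retract_sub_one_mem (r : Rˣ) :
    (r : R) * ((S.retract r)⁻¹ : Rˣ) - 1 ∈ I := by
  have h := I.mul_mem_right (((S.retract r)⁻¹ : Rˣ) : R) (S.sub_map_mem r)
  rwa [← S.coe_retract, sub_mul, Units.mul_inv] at h

lemma retract_eq_one {x : R} (hx : x ∈ I) {w : Rˣ} (hw : (w : R) = 1 + x) : S.retract w = 1 :=
  Units.ext (by rw [coe_retract, hw, map_add, map_one, S.map_eq_zero x hx, add_zero,
    Units.val_one])

/-- The homomorphism `R^* → I`, `r ↦ log (r / σ r)`. -/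
def log : Additive Rˣ →+ R where
  toFun r := logOneAdd N ((r.toMul : R) * ((S.retract r.toMul)⁻¹ : Rˣ) - 1)
  map_zero' := by simp [logOneAdd_zero]
  map_add' r s := by
    rw [← logOneAdd_mul S.one_le S.pow_eq_bot S.isUnit_factorial
      (S.mul_inv_retract_sub_one_mem _) (S.mul_inv_retract_sub_one_mem _), toMul_add, map_mul,
      mul_inv, Units.val_mul, Units.val_mul]
    congr 1
    ring

lemma log_ofMul (r : Rˣ) : S.log (Additive.ofMul r)
    = logOneAdd N ((r : R) * ((S.retract r)⁻¹ : Rˣ) - 1) := rfl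

lemma log_mem (r : Additive Rˣ) : S.log r ∈ I :=
  logOneAdd_mem N (S.mul_inv_retract_sub_one_mem _)

lemma log_of_eq {x : R} (hx : x ∈ I) {w : Rˣ} (hw : (w : R) = 1 + x) :
    S.log (Additive.ofMul w) = logOneAdd N x := by
  rw [log_ofMul, S.retract_eq_one hx hw, inv_one, Units.val_one, mul_one, hw,
    add_sub_cancel_left]

lemma dlogUnit_eq (r : Rˣ) : dlogUnit r
    = dlogUnit (S.retract r) + KaehlerDifferential.D ℤ R (S.log (Additive.ofMul r)) := by
  rw [log_ofMul, D_logOneAdd S.one_le S.isUnit_factorial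
    (pow_eq_zero_of_mem S.pow_eq_bot (S.mul_inv_retract_sub_one_mem r)) (r * (S.retract r)⁻¹)
    (by rw [Units.val_mul]; ring), ← dlogUnit_mul, mul_comm, inv_mul_cancel_right]

/-- The Steinberg relation for the integral of `d log`: if `t = 1 - r`, then the `1`-form
`log (r / σ r) dt/t - log (t / σ t) d(σ r)/σ r` is the differential of an element of `I`,
a truncated dilogarithm. -/
lemma exists_dilog (r t : Rˣ) (h : (t : R) = 1 - (r : R)) :
    ∃ f ∈ I, S.log (Additive.ofMul r) • dlogUnit t
      - S.log (Additive.ofMul t) • dlogUnit (S.retract r) = KaehlerDifferential.D ℤ R f := by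
  obtain ⟨M, rfl⟩ := Nat.exists_eq_add_of_le' S.one_le
  set a := S.retract r with ha
  set b := S.retract t with hb
  set x : R := r - a with hx
  set p : R := ((a⁻¹ : Rˣ) : R) with hp
  set q : R := ((b⁻¹ : Rˣ) : R) with hq
  set D := KaehlerDifferential.D ℤ R with hD
  have hxI : x ∈ I := S.sub_map_mem r
  have hxN : x ^ (M + 1) = 0 := pow_eq_zero_of_mem S.pow_eq_bot hxI
  have hab : (b : R) = 1 - a := by
    rw [ha, hb, coe_retract, coe_retract, h, map_sub, map_one]
  have hpa : p * a = 1 := a.inv_mul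
  have hqb : q * b = 1 := b.inv_mul
  have ht : (t : R) = b - x := by rw [h, hab, hx]; ring
  have hr : (r : R) = a + x := by rw [hx]; ring
  have hlr : S.log (Additive.ofMul r) = logOneAdd (M + 1) (p * x) := by
    rw [log_ofMul]
    congr 1
    rw [← ha, ← hp, hr]
    linear_combination hpa
  have hlt : S.log (Additive.ofMul t) = logOneAdd (M + 1) (-(q * x)) := by
    rw [log_ofMul]
    congr 1
    rw [← hb, ← hq, ht]
    linear_combination hqb
  have hDp : D p = (-p ^ 2) • D (a : R) := D.leibniz_of_mul_eq_one hpa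
  have hDq : D q = (q ^ 2) • D (a : R) := by
    have hDb : D (b : R) = -D (a : R) := by
      rw [hab, map_sub, Derivation.map_one_eq_zero, zero_sub]
    rw [D.leibniz_of_mul_eq_one hqb, hDb, smul_neg, neg_smul, neg_neg]
  have hM : IsUnit (M.factorial : R) :=
    isUnit_of_dvd_unit (Nat.cast_dvd_cast (Nat.factorial_dvd_factorial (by omega)))
      S.isUnit_factorial
  have hDx : x ^ M • D x = 0 := pow_pred_smul_derivation_eq_zero D
    (isUnit_natCast_of_factorial S.isUnit_factorial (by omega) le_rfl) hxN
  -- `s = - λ r / t`, so that `λ r · dt/t = s (da + dx)`.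
  set s : R := ∑ m ∈ Finset.range (M + 1), dilogCoeff p q m * x ^ m with hs
  have hsum : s * t = -logOneAdd (M + 1) (p * x) := by
    rw [ht, mul_comm, hs, sub_mul_sum_dilogCoeff p q b x hqb, hxN, mul_zero, sub_zero]
  refine ⟨dilogSum p q x M, I.sum_mem fun m _ => I.mul_mem_left _
    (I.pow_mem_of_mem hxI _ (by omega)), ?_⟩
  -- The top term of `s` does not contribute to the coefficient of `dx`.
  have hDs : (∑ m ∈ Finset.range M, dilogCoeff p q m * x ^ m) • D x = s • D x := by
    rw [hs, Finset.sum_range_succ, add_smul, mul_smul, hDx, smul_zero, add_zero]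
  have hDt : D (t : R) = -(D (a : R) + D x) := by
    rw [h, hr, map_sub, Derivation.map_one_eq_zero, zero_sub, map_add]
  have hstt : s = -logOneAdd (M + 1) (p * x) * ((t⁻¹ : Rˣ) : R) := by
    rw [← hsum, mul_assoc, Units.mul_inv, mul_one]
  rw [derivation_dilogSum D hDp hDq x M hM, hDs, ← hs, hlr, hlt, dlogUnit, dlogUnit, ← hD, hDt,
    ← hp, smul_smul, smul_smul, smul_neg, smul_add, hstt, neg_mul, neg_smul, sub_smul, neg_smul,
    neg_add, mul_comm _ p]
  abel

end SplitNilpotent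

/-! ### The integral of `d log` in the exterior algebra -/

section Integral

variable {R : Type u} [CommRing R]

/-- The form `dr_1/r_1 ∧ ⋯ ∧ dr_n/r_n` in the exterior algebra. -/
def dlogProd {n : ℕ} (r : Fin n → Rˣ) : AllForms R :=
  ExteriorAlgebra.ιMulti R n fun j => dlogUnit (r j)

lemma coe_wedge_dlogUnit {n : ℕ} (r : Fin n → Rˣ) :
    ((wedge fun j => dlogUnit (r j) : Forms R n) : AllForms R) = dlogProd r := rfl

lemma dlogProd_succ {n : ℕ} (r : Fin (n + 1) → Rˣ) :
    dlogProd r = ExteriorAlgebra.ι R (dlogUnit (r 0)) * dlogProd (Fin.tail r) :=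
  ExteriorAlgebra.ιMulti_succ_apply _

lemma dlogProd_cons {n : ℕ} (a : Rˣ) (r : Fin n → Rˣ) :
    dlogProd (Fin.cons a r : Fin (n + 1) → Rˣ)
      = ExteriorAlgebra.ι R (dlogUnit a) * dlogProd r :=
  dlogProd_succ _

lemma dlogProd_zero (r : Fin 0 → Rˣ) : dlogProd r = 1 :=
  ExteriorAlgebra.ιMulti_zero_apply _

lemma dlogProd_insertNth {n : ℕ} (i : Fin (n + 1)) (w : Rˣ) (r : Fin n → Rˣ) :
    dlogProd (Fin.insertNth i w r : Fin (n + 1) → Rˣ)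
      = (-1 : ℤ) ^ (i : ℕ) • dlogProd (Fin.cons w r : Fin (n + 1) → Rˣ) := by
  induction n with
  | zero =>
    obtain rfl : i = 0 := Fin.fin_one_eq_zero i
    rw [Fin.insertNth_zero']; simp
  | succ n ih =>
    induction i using Fin.cases with
    | zero => rw [Fin.insertNth_zero']; simp
    | succ i =>
      obtain ⟨a, r, rfl⟩ : ∃ a r', r = Fin.cons a r' := ⟨_, _, (Fin.cons_self_tail r).symm⟩
      rw [Fin.insertNth_succ_cons, dlogProd_cons, ih, dlogProd_cons, dlogProd_cons,
        dlogProd_cons, mul_smul_comm, ← mul_assoc, ι_mul_ι_anti, Fin.val_succ, pow_succ,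
        mul_neg_one, neg_smul, neg_mul, smul_neg, mul_assoc]

lemma dlogProd_eq_zero_of_steinberg {n : ℕ} (r : Fin n → Rˣ) (i j : Fin n) (hij : i ≠ j)
    (h : (r j : R) = 1 - (r i : R)) : dlogProd r = 0 := by
  rw [← coe_wedge_dlogUnit, wedge_dlog_steinberg r i j hij h]; rfl

lemma dAll_ι_mul (x : Ω[R⁄ℤ]) (η : AllForms R) :
    dAll R (ExteriorAlgebra.ι R x * η)
      = dOne x * (twistedAll R η).1 - ExteriorAlgebra.ι R x * dAll R η := by
  change (twistedAll R _).2 = _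
  rw [twistedAll_ι_mul, twistedMul_apply]
  rfl

lemma twistedAll_fst (η : AllForms R) : (twistedAll R η).1 = η := by
  induction η using CliffordAlgebra.left_induction with
  | algebraMap r =>
    rw [Algebra.algebraMap_eq_smul_one, map_smul, Twisted.smul_def]
    exact congrArg (r • ·) (congrArg Prod.fst twistedAll_one)
  | add x y hx hy => rw [map_add]; exact congrArg₂ (· + ·) hx hy
  | ι_mul x m hx =>
    exact (congrArg Prod.fst (twistedAll_ι_mul m x)).trans
      (congrArg (ExteriorAlgebra.ι R m * ·) hx)

lemma dAll_smul (f : R) (η : AllForms R) : dAll R (f • η) = f • dAll R η + dd f * η := by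
  change (twistedAll R _).2 = _
  rw [map_smul, Twisted.smul_def]
  change f • _ + dd f * (twistedAll R η).1 = _
  rw [twistedAll_fst]; rfl

/-- Logarithmic `1`-forms are closed. -/
lemma dOne_dlogUnit (r : Rˣ) : dOne (dlogUnit r) = 0 := by
  -- `r • dlogUnit r = dr`, so `dr ∧ dlogUnit r + r d (dlogUnit r) = 0`, and the first term is
  -- `r dlogUnit r ∧ dlogUnit r`.
  have h : (r : R) • dlogUnit r = KaehlerDifferential.D ℤ R (r : R) := by
    rw [dlogUnit, smul_smul, Units.mul_inv, one_smul]
  have h2 := congrArg dOne h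
  rw [dOne_smul, dOne_D, dd, ← h, map_smul, smul_mul_assoc, ExteriorAlgebra.ι_sq_zero, smul_zero,
    add_zero] at h2
  exact (Units.isUnit r).smul_eq_zero.mp h2

lemma dAll_dlogUnit_mul (a : Rˣ) (η : AllForms R) :
    dAll R (ExteriorAlgebra.ι R (dlogUnit a) * η)
      = -(ExteriorAlgebra.ι R (dlogUnit a) * dAll R η) := by
  rw [dAll_ι_mul, dOne_dlogUnit, zero_mul, zero_sub]

lemma dAll_one : dAll R 1 = 0 := congrArg Prod.snd twistedAll_one

lemma dAll_dlogProd {n : ℕ} (r : Fin n → Rˣ) : dAll R (dlogProd r) = 0 := by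
  induction n with
  | zero => rw [dlogProd_zero, dAll_one]
  | succ n ih => rw [dlogProd_succ, dAll_dlogUnit_mul, ih, mul_zero, neg_zero]

lemma dAll_smul_dlogProd {n : ℕ} (f : R) (r : Fin n → Rˣ) :
    dAll R (f • dlogProd r) = dd f * dlogProd r := by
  rw [dAll_smul, dAll_dlogProd, smul_zero, zero_add]

/-- The forms `f dr_1/r_1 ∧ ⋯ ∧ dr_m/r_m` with `f ∈ I` and `m + 1 = n`, and their sums; the index
is the length `n` of the symbols integrated, one more than the degree. -/
def logForms (I : Ideal R) (n : ℕ) : AddSubgroup (AllForms R) :=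
  AddSubgroup.closure {η | ∃ (m : ℕ) (r : Fin m → Rˣ), m + 1 = n ∧ ∃ f ∈ I, η = f • dlogProd r}

/-- The differentials `df ∧ dr_1/r_1 ∧ ⋯ ∧ dr_m/r_m` with `f ∈ I` and `m + 2 = n`, and their sums;
the index is the length `n` of the symbols integrated, one more than the degree. -/
def exactLogForms (I : Ideal R) (n : ℕ) : AddSubgroup (AllForms R) :=
  AddSubgroup.closure
    {η | ∃ (m : ℕ) (r : Fin m → Rˣ), m + 2 = n ∧ ∃ f ∈ I, η = dd f * dlogProd r}

variable {I : Ideal R} {N : ℕ}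

lemma smul_dlogProd_mem {n : ℕ} {f : R} (hf : f ∈ I) (r : Fin n → Rˣ) :
    f • dlogProd r ∈ logForms I (n + 1) :=
  AddSubgroup.subset_closure ⟨n, r, rfl, f, hf, rfl⟩

lemma dd_mul_dlogProd_mem {n : ℕ} {f : R} (hf : f ∈ I) (r : Fin n → Rˣ) :
    dd f * dlogProd r ∈ exactLogForms I (n + 2) :=
  AddSubgroup.subset_closure ⟨n, r, rfl, f, hf, rfl⟩

lemma dlogUnit_mul_mem_logForms (a : Rˣ) {n : ℕ} {η : AllForms R} (h : η ∈ logForms I n) :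
    ExteriorAlgebra.ι R (dlogUnit a) * η ∈ logForms I (n + 1) := by
  induction h using AddSubgroup.closure_induction with
  | mem η h =>
    obtain ⟨m, r, rfl, f, hf, rfl⟩ := h
    rw [mul_smul_comm, ← dlogProd_cons]
    exact smul_dlogProd_mem hf _
  | zero => rw [mul_zero]; exact zero_mem _
  | add x y _ _ hx hy => rw [mul_add]; exact add_mem hx hy
  | neg x _ hx => rw [mul_neg]; exact neg_mem hx

lemma dlogUnit_mul_mem_exactLogForms (a : Rˣ) {n : ℕ} {η : AllForms R}
    (h : η ∈ exactLogForms I n) :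
    ExteriorAlgebra.ι R (dlogUnit a) * η ∈ exactLogForms I (n + 1) := by
  induction h using AddSubgroup.closure_induction with
  | mem η h =>
    obtain ⟨m, r, rfl, f, hf, rfl⟩ := h
    rw [dd, ← mul_assoc, ι_mul_ι_anti, neg_mul, mul_assoc, ← dlogProd_cons]
    exact neg_mem (dd_mul_dlogProd_mem hf _)
  | zero => rw [mul_zero]; exact zero_mem _
  | add x y _ _ hx hy => rw [mul_add]; exact add_mem hx hy
  | neg x _ hx => rw [mul_neg]; exact neg_mem hx

namespace SplitNilpotent

variable (S : SplitNilpotent I N)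

/-- The integral of `d log` on tensors of units, as a multilinear map: by recursion, the symbol
`r_0 ⊗ r_1 ⊗ ⋯ ⊗ r_n` goes to
`log (r_0 / σ r_0) dr_1/r_1 ∧ ⋯ ∧ dr_n/r_n - d(σ r_0)/σ r_0 ∧ integral (r_1 ⊗ ⋯ ⊗ r_n)`. -/
def integralMulti : (n : ℕ) → MultilinearMap ℤ (fun _ : Fin n => Additive Rˣ) (AllForms R)
  | 0 => 0
  | n + 1 => LinearMap.uncurryLeft (AddMonoidHom.toIntLinearMap
      { toFun := fun r => S.log r •
            (((ExteriorAlgebra.ιMulti R n (M := Ω[R⁄ℤ])).toMultilinearMap.restrictScalars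
              ℤ).compLinearMap fun _ => (dlogOne R).toIntLinearMap)
          - (LinearMap.mulLeft ℤ
              (ExteriorAlgebra.ι R (dlogUnit (S.retract r.toMul)))).compMultilinearMap
              (integralMulti n)
        map_zero' := by
          ext m
          simp [dlogUnit]
        map_add' := fun r s => by
          ext m
          simp [dlogUnit_mul, add_smul, add_mul]
          abel })

/-- The integral of `d log` on the symbol `r_1 ⊗ ⋯ ⊗ r_n`. -/
def integral {n : ℕ} (r : Fin n → Rˣ) : AllForms R :=
  S.integralMulti n fun j => Additive.ofMul (r j)

lemma integral_succ {n : ℕ} (r : Fin (n + 1) → Rˣ) :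
    S.integral r = S.log (Additive.ofMul (r 0)) • dlogProd (Fin.tail r)
      - ExteriorAlgebra.ι R (dlogUnit (S.retract (r 0))) * S.integral (Fin.tail r) := rfl

lemma integral_cons {n : ℕ} (a : Rˣ) (r : Fin n → Rˣ) :
    S.integral (Fin.cons a r : Fin (n + 1) → Rˣ) = S.log (Additive.ofMul a) • dlogProd r
      - ExteriorAlgebra.ι R (dlogUnit (S.retract a)) * S.integral r := rfl

lemma integral_mem {n : ℕ} (r : Fin n → Rˣ) : S.integral r ∈ logForms I n := by
  induction n with
  | zero => exact zero_mem _
  | succ n ih =>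
    rw [integral_succ]
    exact sub_mem (smul_dlogProd_mem (S.log_mem _) _) (dlogUnit_mul_mem_logForms _ (ih _))

/-- The integral is a primitive of `d log`, up to its value on the retracted symbol. -/
lemma dAll_integral {n : ℕ} (r : Fin n → Rˣ) :
    dAll R (S.integral r) = dlogProd r - dlogProd fun j => S.retract (r j) := by
  induction n with
  | zero => rw [dlogProd_zero, dlogProd_zero, sub_self]; exact map_zero _
  | succ n ih =>
    rw [integral_succ, map_sub, dAll_smul_dlogProd, dAll_dlogUnit_mul, ih, dlogProd_succ,
      dlogProd_succ fun j => S.retract (r j), S.dlogUnit_eq (r 0), map_add, add_mul,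
      mul_sub, dd]
    change _ = _ - _ * dlogProd fun j => S.retract (Fin.tail r j)
    abel

/-- The integral respects the Steinberg relations modulo exact forms. -/
lemma integral_steinberg {n : ℕ} (r : Fin n → Rˣ) (i j : Fin n) (hij : (j : ℕ) = (i : ℕ) + 1)
    (h : (r j : R) = 1 - (r i : R)) : S.integral r ∈ exactLogForms I n := by
  induction n with
  | zero => exact i.elim0
  | succ n ih =>
    induction j using Fin.cases with
    | zero => simp at hij
    | succ j =>
    induction i using Fin.cases with
    | succ i =>
      have hij' : (j : ℕ) = (i : ℕ) + 1 := by simpa using hij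
      have hne : i ≠ j := fun e => by rw [e] at hij'; omega
      rw [integral_succ, dlogProd_eq_zero_of_steinberg (Fin.tail r) i j hne h, smul_zero, zero_sub]
      exact neg_mem (dlogUnit_mul_mem_exactLogForms _ (ih (Fin.tail r) i j hij' h))
    | zero =>
      obtain ⟨n, rfl⟩ : ∃ m, n = m + 1 := ⟨n - 1, by have := j.2; omega⟩
      obtain rfl : j = 0 := Fin.ext (by simpa using hij)
      obtain ⟨a, r, rfl⟩ : ∃ a r', r = Fin.cons a r' := ⟨_, _, (Fin.cons_self_tail r).symm⟩
      obtain ⟨b, r, rfl⟩ : ∃ a r', r = Fin.cons a r' := ⟨_, _, (Fin.cons_self_tail r).symm⟩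
      have hab : (b : R) = 1 - (a : R) := h
      have hσ : (S.retract b : R) = 1 - (S.retract a : R) := by simp [hab]
      have hz : ExteriorAlgebra.ι R (dlogUnit (S.retract a))
          * ExteriorAlgebra.ι R (dlogUnit (S.retract b)) = 0 := by
        have e := dlogProd_eq_zero_of_steinberg ![S.retract a, S.retract b] 0 1 (by simp) hσ
        rw [dlogProd_succ, dlogProd_succ, dlogProd_zero, mul_one] at e
        exact e
      obtain ⟨f, hf, hF⟩ := S.exists_dilog a b hab
      have e : S.integral (Fin.cons a (Fin.cons b r : Fin (n + 1) → Rˣ) : Fin (n + 2) → Rˣ)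
          = dd f * dlogProd r := by
        rw [integral_cons, integral_cons, dlogProd_cons, mul_sub, ← mul_assoc _ _ (S.integral r),
          hz, zero_mul, sub_zero, dd, ← hF, map_sub, map_smul, map_smul, sub_mul, smul_mul_assoc,
          smul_mul_assoc, mul_smul_comm]
      rw [e]
      exact dd_mul_dlogProd_mem hf r

/-- On a symbol with an entry `w` in `1 + I`, the integral is the expected form modulo exact
forms. Moving `w` one place to the right past `a` costs `d (log (a / σ a) log w)`. -/
lemma integral_insertNth {n : ℕ} (i : Fin (n + 1)) (w : Rˣ) (hw : S.retract w = 1)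
    (r : Fin n → Rˣ) :
    S.integral (Fin.insertNth i w r : Fin (n + 1) → Rˣ)
      - (-1 : ℤ) ^ (i : ℕ) • (S.log (Additive.ofMul w) • dlogProd r)
      ∈ exactLogForms I (n + 1) := by
  have hα : dlogUnit (S.retract w) = 0 := by rw [hw]; simp [dlogUnit]
  have hzero : S.integral (Fin.insertNth 0 w r : Fin (n + 1) → Rˣ)
      = S.log (Additive.ofMul w) • dlogProd r := by
    rw [Fin.insertNth_zero', integral_cons, hα, map_zero, zero_mul, sub_zero]
  induction n with
  | zero =>
    obtain rfl : i = 0 := Fin.fin_one_eq_zero i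
    rw [hzero]; simp
  | succ n ih =>
    induction i using Fin.cases with
    | zero => rw [hzero]; simp
    | succ i =>
      obtain ⟨a, r, rfl⟩ : ∃ a r', r = Fin.cons a r' := ⟨_, _, (Fin.cons_self_tail r).symm⟩
      have h0 := ih i r (by
        rw [Fin.insertNth_zero', integral_cons, hα, map_zero, zero_mul, sub_zero])
      have h1 := dlogUnit_mul_mem_exactLogForms (S.retract a) h0
      have h2 := dd_mul_dlogProd_mem (I.mul_mem_left (S.log (Additive.ofMul a))
        (S.log_mem (Additive.ofMul w))) r
      have h3 := sub_mem (zsmul_mem h2 ((-1 : ℤ) ^ (i : ℕ))) h1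
      convert h3 using 1
      rw [Fin.insertNth_succ_cons, integral_cons, dlogProd_insertNth, dlogProd_cons, dlogProd_cons,
        S.dlogUnit_eq w, hα, zero_add, S.dlogUnit_eq a, Fin.val_succ, dd_mul, pow_succ,
        mul_neg_one]
      simp only [mul_sub, map_add, add_mul, smul_add, smul_mul_assoc, mul_smul_comm,
        neg_smul, dd, smul_comm (S.log (Additive.ofMul _)) ((-1 : ℤ) ^ (i : ℕ))]
      abel

end SplitNilpotent

end Integral

/-! ### Generators of the Milnor K-groups -/

section Generators

variable {R : Type u} [CommRing R] {I : Ideal R} {N n : ℕ}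

lemma pureTensor_mem_eq_top {H : AddSubgroup (UnitsTensor R n)} (h : ∀ r, pureTensor r ∈ H)
    (t : UnitsTensor R n) : t ∈ H := by
  induction t using PiTensorProduct.induction_on with
  | smul_tprod k f => exact zsmul_mem (h fun j => (f j).toMul) k
  | add x y hx hy => exact add_mem hx hy

lemma unitsTensor_hom_ext {A : Type v} [AddCommGroup A] {f g : UnitsTensor R n →+ A}
    (h : ∀ r, f (pureTensor r) = g (pureTensor r)) (t : UnitsTensor R n) : f t = g t :=
  pureTensor_mem_eq_top (H := f.eqLocus g) h t

lemma milnorK_hom_ext {A : Type v} [AddCommGroup A] {f g : MilnorK R n →+ A}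
    (h : ∀ r, f (symbol r) = g (symbol r)) (κ : MilnorK R n) : f κ = g κ := by
  induction κ using QuotientAddGroup.induction_on with
  | H t =>
    exact unitsTensor_hom_ext (f := f.comp (QuotientAddGroup.mk' _))
      (g := g.comp (QuotientAddGroup.mk' _)) h t

lemma symbol_update_mul (r : Fin n → Rˣ) (i : Fin n) (a b : Rˣ) :
    symbol (Function.update r i (a * b))
      = symbol (Function.update r i a) + symbol (Function.update r i b) := by
  have hu : ∀ c : Rˣ, pureTensor (Function.update r i c)
      = PiTensorProduct.tprod ℤ
        (Function.update (fun j => Additive.ofMul (r j)) i (Additive.ofMul c)) := fun c => by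
    rw [pureTensor]
    refine congrArg _ (funext fun j => ?_)
    rcases eq_or_ne j i with rfl | hj
    · simp
    · simp [hj]
  simp only [symbol]
  rw [hu, hu, hu, ofMul_mul, MultilinearMap.map_update_add]
  rfl

/-- The subgroup generated by the symbols having an entry in `1 + I`. -/
def unipotentSymbols (I : Ideal R) (n : ℕ) : AddSubgroup (MilnorK R n) :=
  AddSubgroup.closure {κ | ∃ (r : Fin n → Rˣ) (i : Fin n) (x : R),
    x ∈ I ∧ (r i : R) = 1 + x ∧ κ = symbol r}

namespace SplitNilpotent

variable (S : SplitNilpotent I N)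

/-- Retracting the entries of a symbol one at a time changes it at each step by a symbol with the
entry `r / σ r` of `1 + I`. -/
lemma symbol_sub_symbol_retract_mem (r : Fin n → Rˣ) :
    symbol r - symbol (fun j => S.retract (r j)) ∈ unipotentSymbols I n := by
  suffices h : ∀ s : Finset (Fin n),
      symbol r - symbol (s.piecewise (fun j => S.retract (r j)) r) ∈ unipotentSymbols I n by
    simpa using h Finset.univ
  intro s
  induction s using Finset.induction_on with
  | empty => simp
  | insert i s hi ih =>
    set w := s.piecewise (fun j => S.retract (r j)) r with hw
    have hwi : w i = r i := Finset.piecewise_eq_of_notMem _ _ _ hi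
    have h := symbol_update_mul w i (r i * (S.retract (r i))⁻¹) (S.retract (r i))
    rw [inv_mul_cancel_right, ← hwi, Function.update_eq_self, hwi] at h
    rw [Finset.piecewise_insert, ← hw]
    have hmem : symbol (Function.update w i (r i * (S.retract (r i))⁻¹))
        ∈ unipotentSymbols I n :=
      AddSubgroup.subset_closure ⟨_, i, _, S.mul_inv_retract_sub_one_mem (r i), by simp, rfl⟩
    have e := add_mem ih hmem
    rw [h] at e
    convert e using 1
    abel

lemma sub_milnorKMap_mem (κ : MilnorK R n) :
    κ - milnorKMap S.σ κ ∈ unipotentSymbols I n := by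
  have h := milnorK_hom_ext (A := MilnorK R n ⧸ unipotentSymbols I n)
    (f := QuotientAddGroup.mk' (unipotentSymbols I n))
    (g := (QuotientAddGroup.mk' (unipotentSymbols I n)).comp (milnorKMap S.σ))
    (fun r => by
      rw [AddMonoidHom.comp_apply, milnorKMap_symbol, QuotientAddGroup.mk'_apply,
        QuotientAddGroup.mk'_apply, QuotientAddGroup.eq_iff_sub_mem]
      exact S.symbol_sub_symbol_retract_mem r) κ
  rwa [AddMonoidHom.comp_apply, QuotientAddGroup.mk'_apply, QuotientAddGroup.mk'_apply,
    QuotientAddGroup.eq_iff_sub_mem] at h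

/-- `σ` factors through `R/I`, so that it kills the relative K-group. -/
lemma milnorKMap_eq_zero {κ : MilnorK R n} (h : κ ∈ relMilnorK I n) :
    milnorKMap S.σ κ = 0 := by
  have hfac : ∀ κ' : MilnorK R n, milnorKMap S.σ κ'
      = milnorKMap (Ideal.Quotient.lift I S.σ S.map_eq_zero)
        (milnorKMap (Ideal.Quotient.mk I) κ') := fun κ' =>
    milnorK_hom_ext (f := milnorKMap S.σ)
      (g := (milnorKMap (Ideal.Quotient.lift I S.σ S.map_eq_zero)).comp
        (milnorKMap (Ideal.Quotient.mk I)))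
      (fun r => by
        rw [AddMonoidHom.comp_apply, milnorKMap_symbol, milnorKMap_symbol, milnorKMap_symbol]
        rfl) κ'
  rw [relMilnorK, AddMonoidHom.mem_ker] at h
  rw [hfac, h, map_zero]

/-- The relative K-group is generated by the symbols having an entry in `1 + I`. -/
lemma relMilnorK_hom_ext (S : SplitNilpotent I N) {A : Type v} [AddCommGroup A]
    {f g : relMilnorK I (n + 1) →+ A}
    (h : ∀ (i : Fin (n + 1)) (r : Fin n → Rˣ) (x : R) (hx : x ∈ I) (w : Rˣ)
      (hw : (w : R) = 1 + x), f (relSymbol hx w hw i r) = g (relSymbol hx w hw i r)) :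
    f = g := by
  have hle : unipotentSymbols I (n + 1) ≤ (f.eqLocus g).map (relMilnorK I (n + 1)).subtype := by
    rw [unipotentSymbols, AddSubgroup.closure_le]
    rintro _ ⟨r, i, x, hx, hr, rfl⟩
    refine ⟨_, h i (i.removeNth r) x hx (r i) hr, ?_⟩
    simp only [relSymbol, AddSubgroup.coe_subtype, Fin.insertNth_self_removeNth]
  ext κ
  have hκ := S.sub_milnorKMap_mem κ.val
  rw [S.milnorKMap_eq_zero κ.2, sub_zero] at hκ
  obtain ⟨κ', h1, h2⟩ := hle hκ
  obtain rfl : κ' = κ := Subtype.ext h2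
  exact h1

end SplitNilpotent

end Generators

/-! ### The Bloch map -/

section BlochMap

variable {R : Type u} [CommRing R] {I : Ideal R} {N n : ℕ}

lemma deRham_deRham (ω : Forms R n) : deRham R (n + 1) (deRham R n ω) = 0 := by
  induction ω using forms_induction with
  | gen s r =>
    rw [deRham_smul_wedge,
      ← one_smul R (wedge fun j => KaehlerDifferential.D ℤ R ((Fin.cons s r : Fin (n + 1) → R) j)),
      deRham_smul_wedge]
    exact AlternatingMap.map_coord_zero _ 0 (by simp)
  | add x y hx hy => rw [map_add, map_add, hx, hy, add_zero]

lemma deRham_eq_zero_of_mem_relExact {ω : relForms I n} (h : ω ∈ relExact I n) :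
    deRham R n ω.val = 0 := by
  cases n with
  | zero =>
    obtain rfl : ω = 0 := h
    exact map_zero _
  | succ n =>
    obtain ⟨η, rfl⟩ := h
    exact deRham_deRham η.val

variable (I n) in
/-- The inclusion of the relative forms into the exterior algebra. -/
def relFormsCoe : relForms I n →+ AllForms R :=
  (Submodule.subtype (⋀[R]^n Ω[R⁄ℤ])).toAddMonoidHom.comp (relForms I n).subtype.toAddMonoidHom

lemma relFormsCoe_injective : Function.Injective (relFormsCoe I n) :=
  Subtype.val_injective.comp Subtype.val_injective

lemma logForms_le : logForms I (n + 1) ≤ (relFormsCoe I n).range := by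
  rw [logForms, AddSubgroup.closure_le]
  rintro _ ⟨m, r, hm, f, hf, rfl⟩
  obtain rfl : m = n := by omega
  exact ⟨⟨f • wedge fun j => dlogUnit (r j), smul_mem_relForms hf _⟩, rfl⟩

lemma exactLogForms_le : exactLogForms I (n + 1) ≤ (relExact I n).map (relFormsCoe I n) := by
  rw [exactLogForms, AddSubgroup.closure_le]
  rintro _ ⟨m, r, hm, f, hf, rfl⟩
  obtain rfl : n = m + 1 := by omega
  exact ⟨_, ⟨⟨f • wedge fun j => dlogUnit (r j), smul_mem_relForms hf _⟩, rfl⟩,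
    dAll_smul_dlogProd f r⟩

lemma mk_eq_mk_of_sub_mem {ω η : relForms I n}
    (h : relFormsCoe I n ω - relFormsCoe I n η ∈ exactLogForms I (n + 1)) :
    (QuotientAddGroup.mk ω : RelFormsModExact I n) = QuotientAddGroup.mk η := by
  rw [QuotientAddGroup.eq_iff_sub_mem]
  obtain ⟨ζ, h1, h2⟩ := exactLogForms_le h
  rw [← map_sub] at h2
  rwa [← relFormsCoe_injective h2]

namespace SplitNilpotent

variable (S : SplitNilpotent I N)

variable (n) in
/-- The integral of `d log` on `(R^*)^{⊗ n}`, with values in the exterior algebra. -/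
def integralTensor : UnitsTensor R n →+ AllForms R :=
  (PiTensorProduct.lift (S.integralMulti n)).toAddMonoidHom

lemma integralTensor_pureTensor (r : Fin n → Rˣ) :
    S.integralTensor n (pureTensor r) = S.integral r :=
  PiTensorProduct.lift.tprod _

lemma integralTensor_mem (t : UnitsTensor R (n + 1)) :
    S.integralTensor (n + 1) t ∈ (relFormsCoe I n).range :=
  pureTensor_mem_eq_top (H := (relFormsCoe I n).range.comap (S.integralTensor (n + 1)))
    (fun r => by
      rw [AddSubgroup.mem_comap, integralTensor_pureTensor]
      exact logForms_le (S.integral_mem r)) t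

variable (n) in
/-- The integral of `d log` on `(R^*)^{⊗ (n + 1)}`, with values in `Ω^n_{R,I}`. -/
def relIntegral : UnitsTensor R (n + 1) →+ relForms I n :=
  (AddMonoidHom.ofInjective relFormsCoe_injective).symm.toAddMonoidHom.comp
    ((S.integralTensor (n + 1)).codRestrict _ S.integralTensor_mem)

lemma relFormsCoe_relIntegral (t : UnitsTensor R (n + 1)) :
    relFormsCoe I n (S.relIntegral n t) = S.integralTensor (n + 1) t :=
  congrArg Subtype.val
    ((AddMonoidHom.ofInjective relFormsCoe_injective).apply_symm_apply
      ⟨S.integralTensor (n + 1) t, S.integralTensor_mem t⟩)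

lemma deRham_relIntegral (t : UnitsTensor R (n + 1)) :
    deRham R n (S.relIntegral n t).val
      = dlogTensor R (n + 1) t - dlogTensor R (n + 1) (unitsTensorMap S.σ t) := by
  refine unitsTensor_hom_ext
    (f := (deRham R n).comp ((relForms I n).subtype.toAddMonoidHom.comp (S.relIntegral n)))
    (g := dlogTensor R (n + 1) - (dlogTensor R (n + 1)).comp (unitsTensorMap S.σ)) (fun r => ?_) t
  apply Subtype.ext
  rw [AddMonoidHom.sub_apply, AddMonoidHom.comp_apply _ (unitsTensorMap S.σ),
    unitsTensorMap_pureTensor, dlogTensor_pureTensor, dlogTensor_pureTensor]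
  change dAll R (relFormsCoe I n (S.relIntegral n (pureTensor r)))
    = dlogProd r - dlogProd fun j => S.retract (r j)
  rw [relFormsCoe_relIntegral, integralTensor_pureTensor, dAll_integral]

variable (n) in
/-- The Bloch map, extended to all of `K_{n+1}^M(R)` by means of the retraction. -/
def bloch : MilnorK R (n + 1) →+ RelFormsModExact I n :=
  QuotientAddGroup.lift _ ((QuotientAddGroup.mk' (relExact I n)).comp (S.relIntegral n)) (by
    rw [steinberg, AddSubgroup.closure_le]
    rintro _ ⟨r, i, j, hij, hr, rfl⟩
    refine mk_eq_mk_of_sub_mem (η := 0) ?_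
    rw [relFormsCoe_relIntegral, map_zero, sub_zero, integralTensor_pureTensor]
    exact S.integral_steinberg r i j hij hr)

lemma isBlochMap_bloch :
    IsBlochMap I N n ((S.bloch n).comp (relMilnorK I (n + 1)).subtype) := by
  intro i r x hx w hw
  refine mk_eq_mk_of_sub_mem ?_
  have hlog : relFormsCoe I n ((-1 : ℤ) ^ (i : ℕ) • logForm N hx r)
      = (-1 : ℤ) ^ (i : ℕ) • (logOneAdd N x • dlogProd r) :=
    map_zsmul (relFormsCoe I n) _ _
  rw [relFormsCoe_relIntegral, integralTensor_pureTensor, hlog]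
  have h := S.integral_insertNth i w (S.retract_eq_one hx hw) r
  rwa [S.log_of_eq hx hw] at h

lemma deRham_eq_dlog {κ : MilnorK R (n + 1)} (hκ : κ ∈ relMilnorK I (n + 1)) {ω : relForms I n}
    (hω : (QuotientAddGroup.mk ω : RelFormsModExact I n) = S.bloch n κ) :
    deRham R n ω.val = dlog R (n + 1) κ := by
  have hzero := S.milnorKMap_eq_zero hκ
  induction κ using QuotientAddGroup.induction_on with
  | H t =>
    have hmem : ω - S.relIntegral n t ∈ relExact I n := by
      rw [← QuotientAddGroup.eq_iff_sub_mem]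
      exact hω
    have h := deRham_eq_zero_of_mem_relExact hmem
    rw [Submodule.coe_sub, map_sub, sub_eq_zero, deRham_relIntegral] at h
    have hσ : dlogTensor R (n + 1) (unitsTensorMap S.σ t) = 0 :=
      (congrArg (dlog R (n + 1)) hzero).trans (map_zero _)
    rw [h, hσ, sub_zero]
    rfl

end SplitNilpotent

end BlochMap

end BlochMap

end

theorem mainTheorem2 {R : Type*} [CommRing R] (I : Ideal R) (N : ℕ) (hN : 1 ≤ N)
    (hI : I ^ N = ⊥)
    (hsplit : ∃ s : R ⧸ I →+* R, (Ideal.Quotient.mk I).comp s = RingHom.id (R ⧸ I))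
    (hfac : IsUnit (Nat.factorial N : R)) (n : ℕ) :
    ∃ B : BlochMap.relMilnorK I (n + 1) →+ BlochMap.RelFormsModExact I n,
      BlochMap.IsBlochMap I N n B ∧
      (∀ B' : BlochMap.relMilnorK I (n + 1) →+ BlochMap.RelFormsModExact I n,
        BlochMap.IsBlochMap I N n B' → B' = B) ∧
      (∀ (κ : BlochMap.relMilnorK I (n + 1)) (ω : BlochMap.relForms I n),
        (QuotientAddGroup.mk ω : BlochMap.RelFormsModExact I n) = B κ →
          BlochMap.deRham R n (ω : BlochMap.Forms R n)
            = BlochMap.dlog R (n + 1) (κ : BlochMap.MilnorK R (n + 1))) := by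
  obtain ⟨s, hs⟩ := hsplit
  let S : BlochMap.SplitNilpotent I N :=
    { σ := s.comp (Ideal.Quotient.mk I)
      sub_map_mem := fun r =>
        Ideal.Quotient.eq.mp (RingHom.congr_fun hs (Ideal.Quotient.mk I r)).symm
      map_eq_zero := fun x hx => by
        rw [RingHom.comp_apply, Ideal.Quotient.eq_zero_iff_mem.mpr hx, map_zero]
      one_le := hN
      pow_eq_bot := hI
      isUnit_factorial := hfac }
  refine ⟨_, S.isBlochMap_bloch, fun B' hB' => S.relMilnorK_hom_ext fun i r x hx w hw => ?_,
    fun κ ω hω => S.deRham_eq_dlog κ.2 hω⟩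
  rw [hB', S.isBlochMap_bloch]
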